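/- Let $d\ge 1$, let $\mathcal U\subset\mathbb R^d$ be a nondegenerate hyperrectangle, and let $\varphi$ be a polynomial given by its tensor-product Bernstein coefficients $c_i$ $(0\le i\le n)$ of degree $n=(n_1,\dots,n_d)$ on $\mathcal U$. Put $\Omega=\mathcal U\setminus\{\varphi=0\}$, and let $\Lambda\ge 0$ be an integer. On a subcell of $\mathcal U$, or on a face of it, $\varphi$ is represented by its Bernstein coefficients of the same degree relative to that hyperrectangle. **Sign evaluation.** A polynomial is *coefficient monotone in direction $k$* on a hyperrectangle $U$ if its Bernstein coefficients on $U$ satisfy $c_i\le c_{i+e_k}$ for all $i$ with $i_k<n_k$, or $c_i\ge c_{i+e_k}$ for all such $i$. The interval $\mathrm{range}(\varphi,U)=[\theta,\Theta]$ is computed recursively. In dimension 1 and degree at most 4, $\theta$ and $\Theta$ are the exact minimum and maximum of $\varphi$ on $U$. Otherwise start with $\theta=\min_i c_i$, $\Theta=\max_i c_i$ and, in dimension greater than 1, for every direction $k$ in which $\varphi$ is coefficient monotone replace $\theta$ by $\max\{\theta,\inf R_k\}$ and $\Theta$ by $\min\{\Theta,\sup R_k\}$, where $R_k$ is the union of the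 ranges computed on the lower and the upper face of $U$ in direction $k$. Put $\sigma(\varphi,U)=\{\operatorname{sign} r: r\in\mathrm{range}(\varphi,U)\}$. **Subdivision.** In dimension 0, $\varphi$ is always called *simply connected*. In positive dimension, $\varphi$ is simply connected on $U$ if $\sigma(\varphi,U)=\{+1\}$, or $\sigma(\varphi,U)=\{-1\}$, or for some $k$ it is coefficient monotone in direction $k$ and simply connected on the lower and the upper face of $U$ in direction $k$. Starting with $\mathcal U$ at level $0$, a cell on which $\varphi$ is simply connected, or whose level is $\Lambda$, becomes a leaf cell; any other cell is subdivided into its $2^d$ congruent subcells, at the next level. **Labels.** Let $\mathcal G^+$ (resp. $\mathcal G^-$) be the graph whose edges are the pairs of leaf cells that share a $(d-1)$-dimensional face $F$ with $+1\in\sigma(\varphi|_F,F)$ (resp. $-1\in\sigma(\varphi|_F,F)$), and whose vertices are the leaf cells incident to such an edge. The connected components of $\mathcal G^+$ and of $\mathcal G^-$ receive pairwise different labels in $\mathbb N$; a leaf cell has as $\pm$ label that of its component of $\mathcal G^\pm$, and the $\pm$ label is undefined if the cell is not a vertex of $\mathcal G^\pm$. To evaluate the label $\chi(x)$ of a point $x\in\Omega$,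 take any leaf cell containing $x$ and return its $+$ label if $\varphi(x)>0$, its $-$ label if $\varphi(x)<0$; if this label is undefined, first assign to it a new label that has not been used before. **Theorem.** Suppose that $\varphi$ is simply connected on every leaf cell. Then the labels can be assigned, and for every assignment of the labels, every sequence of successive label evaluations and all choices made in them, every point of $\Omega$ can be evaluated next, and the labeling is exact: for any two evaluated points $x,y\in\Omega$ (possibly equal), $\chi(x)=\chi(y)$ if and only if $x$ and $y$ are joined by a path in $\Omega$. If $\varphi(x)>0>\varphi(y)$, then $\chi(x)\ne\chi(y)$. The same holds if $\sigma$ is replaced throughout by any family $\sigma_m(\psi,U)\subseteq\{-1,0,+1\}$ $(m\ge 0$; $\psi$ a Bernstein polynomial on an $m$-dimensional hyperrectangle $U)$ with the following properties: 1. $\operatorname{sign}\psi(x)\in\sigma_m(\psi,U)$ for all $x\in U$. 2. If all Bernstein coefficients of $\psi$ on $U$ are $\ge0$, then $-1\notin\sigma_m(\psi,U)$; if all are $\le0$, then $+1\notin\sigma_m(\psi,U)$. 3. If $\psi$ is coefficient monotone in direction $k$, then $\sigma_m(\psi,U)\subseteq\sigma_{m-1}(\psi|_{U_\alpha},U_\alpha)\cup_0\sigma_{m-1}(\psi|_{U_\beta},U_\beta)$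 for the lower and upper faces $U_\alpha,U_\beta$ in direction $k$, where $s\cup_0t=\{-1,0,+1\}$ if $s\cup t=\{-1,+1\}$, and $s\cup_0 t=s\cup t$ otherwise. 4. $\sigma_0(c,U)=\{\operatorname{sign} c\}$ for a constant $c$. 5. If $\sigma_m(\psi,U)=\{\varepsilon\}$ with $\varepsilon=\pm1$, then $\sigma_{m-1}(\psi|_F,F)=\{\varepsilon\}$ for every $(m-1)$-dimensional face $F$ of $U$. -/

import Mathlib

open Set

namespace BernsteinLabeling

/-! ### Tensor-product Bernstein polynomials on hyperrectangles -/

/-- A `d`-dimensional tensor-product Bernstein polynomial of degree `deg = (n₁, …, n_d)` on the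
nondegenerate hyperrectangle `[lo₁, hi₁] × ⋯ × [lo_d, hi_d]`, given by its Bernstein coefficients.
Multi-indices are functions `Fin d → ℕ`; the coefficients outside `0 ≤ i ≤ deg` carry no
information, and are normalised to `0`. -/
structure BernsteinPoly (d : ℕ) where
  deg : Fin d → ℕ
  lo : Fin d → ℝ
  hi : Fin d → ℝ
  lo_lt_hi : ∀ j, lo j < hi j
  coeff : (Fin d → ℕ) → ℝ
  coeff_eq_zero : ∀ i, ¬ (∀ j, i j ≤ deg j) → coeff i = 0

/-- The one-dimensional Bernstein basis function of degree `η` and index `l` relative to the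
interval `[α, β]`. -/
noncomputable def bernsteinBasis (η : ℕ) (α β : ℝ) (l : ℕ) (x : ℝ) : ℝ :=
  (η.choose l : ℝ) / (β - α) ^ η * (β - x) ^ (η - l) * (x - α) ^ l

namespace BernsteinPoly

variable {d : ℕ}

/-- The multi-indices `0 ≤ i ≤ deg`. -/
def indices (P : BernsteinPoly d) : Finset (Fin d → ℕ) :=
  Fintype.piFinset fun j => Finset.range (P.deg j + 1)

theorem indices_nonempty (P : BernsteinPoly d) : P.indices.Nonempty :=
  ⟨fun _ => 0, by simp [indices]⟩

/-- The hyperrectangle on which the polynomial is given. -/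
def box (P : BernsteinPoly d) : Set (Fin d → ℝ) := Icc P.lo P.hi

/-- The polynomial function `x ↦ ∑ᵢ cᵢ bᵢ(x)`. -/
noncomputable def eval (P : BernsteinPoly d) (x : Fin d → ℝ) : ℝ :=
  ∑ i ∈ P.indices, P.coeff i * ∏ j, bernsteinBasis (P.deg j) (P.lo j) (P.hi j) (i j) (x j)

noncomputable def minCoeff (P : BernsteinPoly d) : ℝ := P.indices.inf' P.indices_nonempty P.coeff

noncomputable def maxCoeff (P : BernsteinPoly d) : ℝ := P.indices.sup' P.indices_nonempty P.coeff

/-- `φ` or `-φ` is coefficient monotone increasing in the direction `k`. -/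
def CoeffMonotone (P : BernsteinPoly d) (k : Fin d) : Prop :=
  (∀ i ∈ P.indices, i k < P.deg k → P.coeff i ≤ P.coeff (i + Pi.single k 1)) ∨
  (∀ i ∈ P.indices, i k < P.deg k → P.coeff (i + Pi.single k 1) ≤ P.coeff i)

/-- The restriction to the lower (`up = false`) or upper (`up = true`) face in the direction `k`:
its Bernstein coefficients are those with `i_k = 0`, respectively `i_k = n_k`. -/
def face (P : BernsteinPoly (d + 1)) (k : Fin (d + 1)) (up : Bool) : BernsteinPoly d where
  deg j := P.deg (k.succAbove j)
  lo j := P.lo (k.succAbove j)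
  hi j := P.hi (k.succAbove j)
  lo_lt_hi j := P.lo_lt_hi (k.succAbove j)
  coeff i := P.coeff (k.insertNth (α := fun _ => ℕ) (if up then P.deg k else 0) i)
  coeff_eq_zero i hi := P.coeff_eq_zero _ fun h => hi fun j => by
    simpa using h (k.succAbove j)

/-- De Casteljau weights at the midpoint: if `g` has Bernstein coefficients `c₀, …, c_η` on
`[α, β]`, then `∑ₘ w(l, m) cₘ` is its `l`-th Bernstein coefficient on the lower half
(`up = false`), respectively the upper half (`up = true`), of `[α, β]`. -/
noncomputable def halfWeight (η : ℕ) (up : Bool) (l m : ℕ) : ℝ :=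
  if up then (if l ≤ m then ((η - l).choose (m - l) : ℝ) / 2 ^ (η - l) else 0)
  else (l.choose m : ℝ) / 2 ^ l

open Classical in
/-- The same polynomial relative to one of the `2 ^ d` congruent subcells of its hyperrectangle;
`s j` tells whether the lower or the upper half is taken in the direction `j`. -/
noncomputable def child (P : BernsteinPoly d) (s : Fin d → Bool) : BernsteinPoly d where
  deg := P.deg
  lo j := if s j then (P.lo j + P.hi j) / 2 else P.lo j
  hi j := if s j then P.hi j else (P.lo j + P.hi j) / 2
  lo_lt_hi j := by
    have h := P.lo_lt_hi j
    by_cases hs : s j = true <;> simp only [hs] <;> simp <;> linarith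
  coeff i := if ∀ j, i j ≤ P.deg j then
      ∑ m ∈ P.indices, (∏ j, halfWeight (P.deg j) (s j) (i j) (m j)) * P.coeff m
    else 0
  coeff_eq_zero i hi := by simp only [if_neg hi]

end BernsteinPoly

/-! ### Sign evaluation -/

/-- The type of a family `σ_d(φ, U)`, `d ≥ 0`; property (i), `σ_d(φ, U) ⊆ {-1, 0, 1}`, is built
into the type. -/
abbrev SignEvaluator := ∀ ⦃d : ℕ⦄, BernsteinPoly d → Set SignType

open Classical in
/-- The union `s ∪₀ t`, which includes zero if `s ∪ t = {-1, 1}`. -/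
noncomputable def unionZero (s t : Set SignType) : Set SignType :=
  if s ∪ t = {-1, 1} then {-1, 0, 1} else s ∪ t

/-- The requirements on a sign evaluation algorithm. -/
structure IsSignEvaluation (σ : SignEvaluator) : Prop where
  sign_mem : ∀ {d : ℕ} (P : BernsteinPoly d), ∀ x ∈ P.box, SignType.sign (P.eval x) ∈ σ P
  of_nonneg : ∀ {d : ℕ} (P : BernsteinPoly d), (∀ i ∈ P.indices, 0 ≤ P.coeff i) → -1 ∉ σ P
  of_nonpos : ∀ {d : ℕ} (P : BernsteinPoly d), (∀ i ∈ P.indices, P.coeff i ≤ 0) → 1 ∉ σ P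
  of_monotone : ∀ {d : ℕ} (P : BernsteinPoly (d + 1)) (k : Fin (d + 1)), P.CoeffMonotone k →
    σ P ⊆ unionZero (σ (P.face k false)) (σ (P.face k true))
  of_dim_zero : ∀ P : BernsteinPoly 0, σ P = {SignType.sign (P.coeff 0)}

/-- If `σ` certifies that a polynomial has one strict sign on a hyperrectangle, then it does so on
every face of the hyperrectangle. -/
def IsFaceConsistent (σ : SignEvaluator) : Prop :=
  ∀ {d : ℕ} (P : BernsteinPoly (d + 1)) (k : Fin (d + 1)) (up : Bool),
    (σ P = {1} → σ (P.face k up) = {1}) ∧ (σ P = {-1} → σ (P.face k up) = {-1})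

open Classical in
/-- The range evaluation algorithm; the output is the pair of endpoints `(θ, Θ)`. In dimension one
and degree at most four the range is computed exactly. Otherwise one starts with the extreme
Bernstein coefficients, and in dimension greater than one improves them through the faces in every
direction of coefficient monotonicity. -/
noncomputable def evalRange : {d : ℕ} → BernsteinPoly d → ℝ × ℝ
  | 0, P => (P.minCoeff, P.maxCoeff)
  | 1, P =>
    if P.deg 0 ≤ 4 then (sInf (P.eval '' P.box), sSup (P.eval '' P.box))
    else (P.minCoeff, P.maxCoeff)
  | d + 2, P =>
    (List.finRange (d + 2)).foldl
      (fun I k =>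
        if P.CoeffMonotone k then
          (max I.1 (min (evalRange (P.face k false)).1 (evalRange (P.face k true)).1),
            min I.2 (max (evalRange (P.face k false)).2 (evalRange (P.face k true)).2))
        else I)
      (P.minCoeff, P.maxCoeff)

/-- The sign evaluation by range evaluation: the signs of the elements of `[θ, Θ]`. -/
noncomputable def rangeSign : SignEvaluator :=
  fun _ P => SignType.sign '' Icc (evalRange P).1 (evalRange P).2

/-! ### Simply connected polynomials and the subdivision tree -/

/-- The simply connected test, relative to a fixed sign evaluation. -/
def IsSimplyConnected (σ : SignEvaluator) : {d : ℕ} → BernsteinPoly d → Prop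
  | 0, _ => True
  | _ + 1, P => σ P = {1} ∨ σ P = {-1} ∨
      ∃ k, P.CoeffMonotone k ∧ IsSimplyConnected σ (P.face k false) ∧
        IsSimplyConnected σ (P.face k true)

/-- A subdivision tree; every leaf holds a cell together with the polynomial relative to it. -/
inductive CellTree (d : ℕ) where
  | leaf (P : BernsteinPoly d) : CellTree d
  | node (children : (Fin d → Bool) → CellTree d) : CellTree d

/-- The leaf cells of a subdivision tree. -/
def CellTree.leaves {d : ℕ} : CellTree d → Set (BernsteinPoly d)
  | .leaf P => {P}
  | .node ch => ⋃ s, (ch s).leaves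

open Classical in
/-- First phase of the construction. The argument `r` is the number `Λ - ℓ` of levels still
available, so that the tree for the maximum depth `Λ` is `subdivide σ Λ φ`. -/
noncomputable def subdivide (σ : SignEvaluator) {d : ℕ} : ℕ → BernsteinPoly d → CellTree d
  | 0, P => .leaf P
  | r + 1, P => if IsSimplyConnected σ P then .leaf P else .node fun s => subdivide σ r (P.child s)

/-! ### Cell connectivity and labels -/

/-- The cells of `P` and `Q` lie on opposite sides of a hyperplane orthogonal to the direction `k`,
and their intersection is the face `(k, up)` of `P`. For two leaf cells of a subdivision tree
whose intersection has codimension one, this holds for the smaller one as `P`. -/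
def MeetsAlong {d : ℕ} (P Q : BernsteinPoly d) (k : Fin d) (up : Bool) : Prop :=
  (if up then P.hi k = Q.lo k else P.lo k = Q.hi k) ∧
    ∀ j, j ≠ k → Q.lo j ≤ P.lo j ∧ P.hi j ≤ Q.hi j

/-- `true` stands for the label kind `+`, and `false` for the label kind `-`. -/
def signOf (s : Bool) : SignType := if s then 1 else -1

/-- The graphs `𝒢⁺` (`s = true`) and `𝒢⁻` (`s = false`) on the leaf cells: an edge joins two leaf
cells sharing a face if the sign evaluation on the shared face contains the sign in question. -/
def cellGraph (σ : SignEvaluator) {d : ℕ} (T : CellTree (d + 1)) (s : Bool) :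
    SimpleGraph T.leaves where
  Adj U V :=
    (∃ k up, MeetsAlong U.1 V.1 k up ∧ signOf s ∈ σ (U.1.face k up)) ∨
    (∃ k up, MeetsAlong V.1 U.1 k up ∧ signOf s ∈ σ (V.1.face k up))
  symm := ⟨fun _ _ h => h.symm⟩
  loopless := ⟨fun U h => by
    have key : ∀ k up, ¬ MeetsAlong U.1 U.1 k up := by
      intro k up hm
      have h1 := U.1.lo_lt_hi k
      have h2 := hm.1
      cases up <;> simp at h2 <;> linarith
    rcases h with ⟨k, up, hm, _⟩ | ⟨k, up, hm, _⟩ <;> exact key k up hm⟩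

/-- The `+` and `-` labels of the leaf cells; `none` means undefined. -/
abbrev LabelTable {d : ℕ} (T : CellTree d) := T.leaves → Bool → Option ℕ

/-- The possible outcomes of the last phase of the construction. Only the leaf cells incident to an
edge are vertices of the graph in question and receive a label; two labels are equal if and only if
they belong to the same connected component of the same graph. -/
def IsInitialTable (σ : SignEvaluator) {d : ℕ} (T : CellTree (d + 1)) (L : LabelTable T) : Prop :=
  (∀ U s, (∃ a, L U s = some a) ↔ ∃ V, (cellGraph σ T s).Adj U V) ∧
  (∀ U V s t a b, L U s = some a → L V t = some b →
    (a = b ↔ s = t ∧ (cellGraph σ T s).Reachable U V))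

/-- Evaluation of the label of the point `x`, when the current label table is `L`: the answer `v` is
the label, of the kind given by the sign of `φ x`, of some leaf cell containing `x`; if that label
is undefined, then a new label is created and stored. `L'` is the label table afterwards. -/
def EvalStep {d : ℕ} (φ : BernsteinPoly d) (T : CellTree d) (L : LabelTable T)
    (x : Fin d → ℝ) (v : ℕ) (L' : LabelTable T) : Prop :=
  ∃ (U : T.leaves) (s : Bool), x ∈ U.1.box ∧ SignType.sign (φ.eval x) = signOf s ∧
    ((L U s = some v ∧ L' = L) ∨
      (L U s = none ∧ (∀ V t, L V t ≠ some v) ∧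
        L' U s = some v ∧ ∀ V t, (V, t) ≠ (U, s) → L' V t = L V t))

/-- `Session φ T L h L'`: beginning with the table `L`, the points listed in `h` are evaluated one
after the other, with the labels listed in `h` as answers, and `L'` is the table in the end. -/
inductive Session {d : ℕ} (φ : BernsteinPoly d) (T : CellTree d) :
    LabelTable T → List ((Fin d → ℝ) × ℕ) → LabelTable T → Prop
  | nil (L : LabelTable T) : Session φ T L [] L
  | cons {L L' L'' : LabelTable T} {x : Fin d → ℝ} {v : ℕ} {h : List ((Fin d → ℝ) × ℕ)} :
      EvalStep φ T L x v L' → Session φ T L' h L'' → Session φ T L ((x, v) :: h) L''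

/-- `Ω = 𝒰 \ {φ = 0}`. -/
def domain {d : ℕ} (φ : BernsteinPoly d) : Set (Fin d → ℝ) := φ.box \ {x | φ.eval x = 0}

/-- The labeling algorithm is exact for `φ`, with the sign evaluation `σ` and the maximum depth `Λ`:
labels can be assigned at the end of the construction, and however this is done, in every session
that follows, every further point of `Ω` can be evaluated, two evaluated points have the same label
if and only if they are joined by a path in `Ω`, and points where `φ` has opposite signs have
different labels. -/
def LabelingIsExact (σ : SignEvaluator) {d : ℕ} (Λ : ℕ) (φ : BernsteinPoly (d + 1)) : Prop :=
  (∃ L₀, IsInitialTable σ (subdivide σ Λ φ) L₀) ∧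
  ∀ L₀, IsInitialTable σ (subdivide σ Λ φ) L₀ →
    ∀ h L, Session φ (subdivide σ Λ φ) L₀ h L →
      (∀ x ∈ domain φ, ∃ v L', EvalStep φ (subdivide σ Λ φ) L x v L') ∧
      ∀ x v y w, (x, v) ∈ h → (y, w) ∈ h →
        (v = w ↔ JoinedIn (domain φ) x y) ∧ (0 < φ.eval x → φ.eval y < 0 → v ≠ w)

end BernsteinLabeling

/-!
The proof compares the cell graphs with the path components of `Ω` through two facts about a
polynomial that is simply connected on a cell.

* Its positive and its negative set in the cell are path connected
  (`IsSimplyConnected.joinedIn`). Coefficient monotonicity in the direction `k` makes the polynomial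
  monotone in `x_k` (`CoeffMonotone.monotoneOn_or_antitoneOn`), so that all points of one sign can
  be moved to the same face in that direction, where the claim holds by induction on the dimension.
* Its sign set contains a strict sign only if this sign occurs in the cell
  (`IsSimplyConnected.exists_sign_eq`), again by induction through the faces.

Face consistency carries simple connectedness over to all faces (`IsSimplyConnected.face`). Hence an
edge of `𝒢⁺` or `𝒢⁻` means that the sign in question occurs on the shared face, and walking along
edges produces paths in `Ω` (`joinedIn_of_reachable`).

For the converse, a path in `Ω` has constant sign, and the finitely many leaf cells cover it by
closed sets. By connectedness it is enough that all leaf cells containing one point `x` of a given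
sign are connected in the graph (`reachable_of_mem_box`). Each germ of an orthant at `x` lies in
exactly one leaf cell. If two germs differ in one coordinate, their leaf cells coincide or are
dyadic neighbours, nested in the other coordinates, that share a face through `x`; as the sign
occurs at `x`, this face gives an edge. Reversing one coordinate after the other connects all germs.

Label evaluations keep the correspondence between labels and components
(`IsValidTable.evalStep`), because a cell whose label is undefined is isolated in its graph.

Finally, range evaluation meets the requirements. Its endpoints enclose the values of the polynomial
and lie between the extreme coefficients, and a strict sign found through one direction of
monotonicity is found on every face through the same direction (`evalRange_face_sign`).
-/

namespace BernsteinLabeling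

/-! ### Univariate Bernstein polynomials -/

section Univariate

variable {α β x : ℝ}

lemma bernsteinBasis_nonneg (η l : ℕ) (hx : x ∈ Icc α β) : 0 ≤ bernsteinBasis η α β l x := by
  have h1 : 0 ≤ β - x := sub_nonneg.2 hx.2
  have h2 : 0 ≤ x - α := sub_nonneg.2 hx.1
  have h3 : 0 ≤ β - α := by linarith
  unfold bernsteinBasis
  positivity

lemma bernsteinBasis_eq_normalized (h : α < β) {η l : ℕ} (hl : l ≤ η) (x : ℝ) :
    bernsteinBasis η α β l x =
      η.choose l * (((x - α) / (β - α)) ^ l * (1 - (x - α) / (β - α)) ^ (η - l)) := by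
  have h0 : β - α ≠ 0 := by linarith
  have h1 : 1 - (x - α) / (β - α) = (β - x) / (β - α) := by field_simp; ring
  have h2 : (β - α) ^ η = (β - α) ^ l * (β - α) ^ (η - l) := by
    rw [← pow_add, Nat.add_sub_cancel' hl]
  rw [h1, bernsteinBasis, h2, div_pow, div_pow]
  field_simp

lemma sum_bernsteinBasis (h : α < β) (η : ℕ) (x : ℝ) :
    ∑ l ∈ Finset.range (η + 1), bernsteinBasis η α β l x = 1 := by
  have := add_pow ((x - α) / (β - α)) (1 - (x - α) / (β - α)) η
  rw [add_sub_cancel, one_pow] at this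
  rw [this]
  refine Finset.sum_congr rfl fun l hl => ?_
  rw [bernsteinBasis_eq_normalized h (Finset.mem_range_succ_iff.1 hl)]
  ring

lemma bernsteinBasis_left (h : α < β) {η l : ℕ} (hl : l ≤ η) :
    bernsteinBasis η α β l α = if l = 0 then 1 else 0 := by
  rw [bernsteinBasis_eq_normalized h hl]
  rcases eq_or_ne l 0 with rfl | h0 <;> simp [*]

lemma bernsteinBasis_right (h : α < β) {η l : ℕ} (hl : l ≤ η) :
    bernsteinBasis η α β l β = if l = η then 1 else 0 := by
  rw [bernsteinBasis_eq_normalized h hl, div_self (by linarith)]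
  rcases eq_or_ne l η with rfl | h0
  · simp
  · have : η - l ≠ 0 := by omega
    simp [*]

/-- A Bernstein polynomial on `[0, 1]` with increasing coefficients is increasing. By Pascal's rule
it is the convex combination, with weights `1 - t` and `t`, of two Bernstein polynomials of lower
degree, both increasing, and the second one dominates the first one. -/
lemma sum_antidiagonal_bernstein_mono (n : ℕ) (a : ℕ → ℝ) (ha : ∀ l < n, a l ≤ a (l + 1))
    {s t : ℝ} (hs : 0 ≤ s) (hst : s ≤ t) (ht : t ≤ 1) :
    ∑ ij ∈ Finset.HasAntidiagonal.antidiagonal n,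
        (n.choose ij.1 : ℝ) * (a ij.1 * (s ^ ij.1 * (1 - s) ^ ij.2)) ≤
      ∑ ij ∈ Finset.HasAntidiagonal.antidiagonal n,
        (n.choose ij.1 : ℝ) * (a ij.1 * (t ^ ij.1 * (1 - t) ^ ij.2)) := by
  induction n generalizing a with
  | zero => simp
  | succ n ih =>
    set g : (ℕ → ℝ) → ℝ → ℝ := fun a t => ∑ ij ∈ Finset.HasAntidiagonal.antidiagonal n,
      (n.choose ij.1 : ℝ) * (a ij.1 * (t ^ ij.1 * (1 - t) ^ ij.2)) with hg
    have key : ∀ u : ℝ, ∑ ij ∈ Finset.HasAntidiagonal.antidiagonal (n + 1),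
        ((n + 1).choose ij.1 : ℝ) * (a ij.1 * (u ^ ij.1 * (1 - u) ^ ij.2)) =
          (1 - u) * g a u + u * g (fun l => a (l + 1)) u := by
      intro u
      rw [Finset.sum_antidiagonal_choose_succ_mul fun i j => a i * (u ^ i * (1 - u) ^ j), hg]
      simp only [Finset.mul_sum]
      congr 1
      · exact Finset.sum_congr rfl fun ij _ => by ring
      · refine Finset.sum_congr rfl fun ij hij => ?_
        rw [Nat.choose_symm_of_eq_add (Finset.HasAntidiagonal.mem_antidiagonal.1 hij).symm]
        ring
    rw [key, key]
    have h1 := ih a (fun l hl => ha l (by omega))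
    have h2 := ih (fun l => a (l + 1)) (fun l hl => ha (l + 1) (by omega))
    have h3 : g a t ≤ g (fun l => a (l + 1)) t := by
      refine Finset.sum_le_sum fun ij hij => ?_
      have h4 : ij.1 < n + 1 := by have := Finset.HasAntidiagonal.mem_antidiagonal.1 hij; omega
      have h5 : 0 ≤ 1 - t := by linarith
      have h6 : 0 ≤ t := by linarith
      have := ha _ h4
      gcongr
    change g a s ≤ g a t at h1
    change g (fun l => a (l + 1)) s ≤ g (fun l => a (l + 1)) t at h2
    nlinarith [mul_le_mul_of_nonneg_left h1 (show 0 ≤ 1 - s by linarith),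
      mul_le_mul_of_nonneg_left h2 hs, mul_nonneg (sub_nonneg.2 hst) (sub_nonneg.2 h3)]

lemma monotoneOn_sum_bernsteinBasis (h : α < β) (η : ℕ) (a : ℕ → ℝ)
    (ha : ∀ l < η, a l ≤ a (l + 1)) :
    MonotoneOn (fun x => ∑ l ∈ Finset.range (η + 1), a l * bernsteinBasis η α β l x)
      (Icc α β) := by
  have h0 : 0 < β - α := by linarith
  have key : ∀ x, ∑ l ∈ Finset.range (η + 1), a l * bernsteinBasis η α β l x =
      ∑ ij ∈ Finset.HasAntidiagonal.antidiagonal η, (η.choose ij.1 : ℝ) * (a ij.1 *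
        (((x - α) / (β - α)) ^ ij.1 * (1 - (x - α) / (β - α)) ^ ij.2)) := by
    intro x
    rw [Finset.Nat.sum_antidiagonal_eq_sum_range_succ (fun i j => (η.choose i : ℝ) * (a i *
        (((x - α) / (β - α)) ^ i * (1 - (x - α) / (β - α)) ^ j)))]
    refine Finset.sum_congr rfl fun l hl => ?_
    rw [bernsteinBasis_eq_normalized h (Finset.mem_range_succ_iff.1 hl)]
    ring
  intro x hx y hy hxy
  simp only [key]
  refine sum_antidiagonal_bernstein_mono η a ha (div_nonneg (sub_nonneg.2 hx.1) h0.le) ?_ ?_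
  · gcongr
  · rw [div_le_one h0]; linarith [hy.2]

/-- De Casteljau subdivision: `halfWeight` expresses the Bernstein basis of
`[α, β]` through the one of the lower half. -/
lemma sum_halfWeight_lower (h : α < β) {η m : ℕ} (hm : m ≤ η) (x : ℝ) :
    ∑ l ∈ Finset.range (η + 1),
      BernsteinPoly.halfWeight η false l m * bernsteinBasis η α ((α + β) / 2) l x =
        bernsteinBasis η α β m x := by
  have h0 : β - α ≠ 0 := by linarith
  set u := (x - α) / (β - α) with hu
  have hv : (x - α) / ((α + β) / 2 - α) = 2 * u := by
    rw [hu, show (α + β) / 2 - α = (β - α) / 2 by ring]; field_simp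
  rw [bernsteinBasis_eq_normalized h hm, ← hu]
  have hsplit : η + 1 = m + (η - m + 1) := by omega
  rw [hsplit, Finset.sum_range_add, Finset.sum_eq_zero, zero_add]
  · have hpow := add_pow u (1 - 2 * u) (η - m)
    rw [show 1 - u = u + (1 - 2 * u) by ring, hpow, Finset.mul_sum, Finset.mul_sum]
    refine Finset.sum_congr rfl fun l hl => ?_
    have hl' : m + l ≤ η := by have := Finset.mem_range_succ_iff.1 hl; omega
    rw [bernsteinBasis_eq_normalized (by linarith) hl', hv]
    have hc : (η.choose (m + l) : ℝ) * (m + l).choose m = η.choose m * (η - m).choose l := by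
      have := Nat.choose_mul (n := η) (k := m + l) (s := m) (Nat.le_add_right m l)
      rw [Nat.add_sub_cancel_left] at this
      exact_mod_cast this
    have he : η - (m + l) = η - m - l := by omega
    simp only [BernsteinPoly.halfWeight, Bool.false_eq_true, if_false]
    rw [he, mul_pow]
    field_simp
    rw [mul_comm ((m + l).choose m : ℝ), hc]
    ring
  · intro l hl
    simp [BernsteinPoly.halfWeight, Nat.choose_eq_zero_of_lt (Finset.mem_range.1 hl)]

/-- The analogue of `sum_halfWeight_lower` for the upper half. -/
lemma sum_halfWeight_upper (h : α < β) {η m : ℕ} (hm : m ≤ η) (x : ℝ) :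
    ∑ l ∈ Finset.range (η + 1),
      BernsteinPoly.halfWeight η true l m * bernsteinBasis η ((α + β) / 2) β l x =
        bernsteinBasis η α β m x := by
  have h0 : β - α ≠ 0 := by linarith
  set u := (x - α) / (β - α) with hu
  have hv : (x - (α + β) / 2) / (β - (α + β) / 2) = 2 * u - 1 := by
    rw [hu, show β - (α + β) / 2 = (β - α) / 2 by ring]; field_simp; ring
  rw [bernsteinBasis_eq_normalized h hm, ← hu]
  have hsplit : η + 1 = m + 1 + (η - m) := by omega
  rw [hsplit, Finset.sum_range_add, Finset.sum_eq_zero (s := Finset.range (η - m)), add_zero]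
  · have hpow := add_pow (2 * u - 1) (1 - u) m
    rw [show 2 * u - 1 + (1 - u) = u by ring] at hpow
    rw [hpow, Finset.sum_mul, Finset.mul_sum]
    refine Finset.sum_congr rfl fun l hl => ?_
    have hl' : l ≤ m := Finset.mem_range_succ_iff.1 hl
    rw [bernsteinBasis_eq_normalized (by linarith) (hl'.trans hm), hv]
    have hc : (η.choose l : ℝ) * (η - l).choose (m - l) = η.choose m * m.choose l := by
      exact_mod_cast (Nat.choose_mul (n := η) (k := m) (s := l) hl').symm
    have he : η - l = (m - l) + (η - m) := by omega
    simp only [BernsteinPoly.halfWeight, if_true, if_pos hl']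
    rw [show 1 - (2 * u - 1) = 2 * (1 - u) by ring, mul_pow]
    have h2 : (2 : ℝ) ^ (η - l) ≠ 0 := by positivity
    have h3 : (1 - u) ^ (η - l) = (1 - u) ^ (m - l) * (1 - u) ^ (η - m) := by rw [he, pow_add]
    rw [h3]
    field_simp
    rw [mul_comm ((η - l).choose (m - l) : ℝ), hc]
    ring
  · intro l _
    simp [BernsteinPoly.halfWeight, show ¬ m + 1 + l ≤ m by omega]

end Univariate

/-! ### Evaluation of tensor-product Bernstein polynomials -/

namespace BernsteinPoly

variable {d : ℕ}

lemma mem_indices {P : BernsteinPoly d} {i : Fin d → ℕ} :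
    i ∈ P.indices ↔ ∀ j, i j ≤ P.deg j := by
  simp [indices]

lemma mem_box {P : BernsteinPoly d} {x : Fin d → ℝ} :
    x ∈ P.box ↔ ∀ j, P.lo j ≤ x j ∧ x j ≤ P.hi j := by
  simp [box, Pi.le_def, forall_and]

lemma lo_mem_box (P : BernsteinPoly d) : P.lo ∈ P.box :=
  mem_box.2 fun j => ⟨le_rfl, (P.lo_lt_hi j).le⟩

lemma continuous_eval (P : BernsteinPoly d) : Continuous P.eval := by
  unfold eval bernsteinBasis
  fun_prop

lemma sum_prod_bernsteinBasis (P : BernsteinPoly d) (x : Fin d → ℝ) :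
    ∑ i ∈ P.indices, ∏ j, bernsteinBasis (P.deg j) (P.lo j) (P.hi j) (i j) (x j) = 1 := by
  refine (Finset.prod_univ_sum (fun j => Finset.range (P.deg j + 1)) fun j l =>
    bernsteinBasis (P.deg j) (P.lo j) (P.hi j) l (x j)).symm.trans ?_
  exact Finset.prod_eq_one fun j _ => sum_bernsteinBasis (P.lo_lt_hi j) _ _

lemma prod_bernsteinBasis_nonneg (P : BernsteinPoly d) (i : Fin d → ℕ) {x : Fin d → ℝ}
    (hx : x ∈ P.box) :
    0 ≤ ∏ j, bernsteinBasis (P.deg j) (P.lo j) (P.hi j) (i j) (x j) :=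
  Finset.prod_nonneg fun j _ => bernsteinBasis_nonneg _ _ (mem_box.1 hx j)

lemma minCoeff_le_coeff (P : BernsteinPoly d) {i : Fin d → ℕ} (hi : i ∈ P.indices) :
    P.minCoeff ≤ P.coeff i :=
  Finset.inf'_le _ hi

lemma coeff_le_maxCoeff (P : BernsteinPoly d) {i : Fin d → ℕ} (hi : i ∈ P.indices) :
    P.coeff i ≤ P.maxCoeff :=
  Finset.le_sup' _ hi

lemma minCoeff_le_eval (P : BernsteinPoly d) {x : Fin d → ℝ} (hx : x ∈ P.box) :
    P.minCoeff ≤ P.eval x := by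
  have h := P.sum_prod_bernsteinBasis x
  calc P.minCoeff = ∑ i ∈ P.indices,
        P.minCoeff * ∏ j, bernsteinBasis (P.deg j) (P.lo j) (P.hi j) (i j) (x j) := by
        rw [← Finset.mul_sum, h, mul_one]
    _ ≤ _ := Finset.sum_le_sum fun i hi =>
        mul_le_mul_of_nonneg_right (P.minCoeff_le_coeff hi) (P.prod_bernsteinBasis_nonneg i hx)

lemma eval_le_maxCoeff (P : BernsteinPoly d) {x : Fin d → ℝ} (hx : x ∈ P.box) :
    P.eval x ≤ P.maxCoeff := by
  have h := P.sum_prod_bernsteinBasis x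
  calc P.eval x ≤ ∑ i ∈ P.indices,
        P.maxCoeff * ∏ j, bernsteinBasis (P.deg j) (P.lo j) (P.hi j) (i j) (x j) :=
        Finset.sum_le_sum fun i hi =>
          mul_le_mul_of_nonneg_right (P.coeff_le_maxCoeff hi) (P.prod_bernsteinBasis_nonneg i hx)
    _ = _ := by rw [← Finset.mul_sum, h, mul_one]

/-- The coefficients of a subcell, computed by the subdivision algorithm, represent the same
polynomial function. -/
lemma eval_child (P : BernsteinPoly d) (s : Fin d → Bool) (x : Fin d → ℝ) :
    (P.child s).eval x = P.eval x := by
  have h1 : ∀ i ∈ (P.child s).indices, (P.child s).coeff i *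
      ∏ j, bernsteinBasis ((P.child s).deg j) ((P.child s).lo j) ((P.child s).hi j) (i j) (x j) =
      ∑ m ∈ P.indices, P.coeff m * ∏ j, halfWeight (P.deg j) (s j) (i j) (m j) *
        bernsteinBasis (P.deg j) ((P.child s).lo j) ((P.child s).hi j) (i j) (x j) := by
    intro i hi
    have hi' : ∀ j, i j ≤ P.deg j := mem_indices.1 hi
    simp only [Finset.prod_mul_distrib]
    rw [show (P.child s).coeff i = _ from if_pos hi', Finset.sum_mul]
    refine Finset.sum_congr rfl fun m _ => ?_
    rw [show (P.child s).deg = P.deg from rfl]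
    ring
  unfold eval
  rw [Finset.sum_congr rfl h1, Finset.sum_comm]
  refine Finset.sum_congr rfl fun m hm => ?_
  rw [← Finset.mul_sum]
  congr 1
  refine (Finset.prod_univ_sum (fun j => Finset.range (P.deg j + 1)) fun j l =>
    halfWeight (P.deg j) (s j) l (m j) * bernsteinBasis (P.deg j) ((P.child s).lo j)
      ((P.child s).hi j) l (x j)).symm.trans ?_
  refine Finset.prod_congr rfl fun j _ => ?_
  have hmj := mem_indices.1 hm j
  rcases hs : s j with _ | _
  · simpa [child, hs] using sum_halfWeight_lower (P.lo_lt_hi j) hmj (x j)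
  · simpa [child, hs] using sum_halfWeight_upper (P.lo_lt_hi j) hmj (x j)

/-- The polynomial in the remaining variables whose Bernstein coefficients are those of `P` with
index `l` in the direction `k`. The two faces in the direction `k` are the extreme slices. -/
def slice (P : BernsteinPoly (d + 1)) (k : Fin (d + 1)) (l : ℕ) : BernsteinPoly d where
  deg j := P.deg (k.succAbove j)
  lo j := P.lo (k.succAbove j)
  hi j := P.hi (k.succAbove j)
  lo_lt_hi j := P.lo_lt_hi (k.succAbove j)
  coeff i := P.coeff (k.insertNth (α := fun _ => ℕ) l i)
  coeff_eq_zero i hi := P.coeff_eq_zero _ fun h => hi fun j => by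
    simpa using h (k.succAbove j)

lemma face_eq_slice (P : BernsteinPoly (d + 1)) (k : Fin (d + 1)) (up : Bool) :
    P.face k up = P.slice k (if up then P.deg k else 0) := rfl

lemma insertNth_mem_indices {P : BernsteinPoly (d + 1)} {k : Fin (d + 1)} {l m : ℕ}
    {i : Fin d → ℕ} : k.insertNth (α := fun _ => ℕ) l i ∈ P.indices ↔
      l ≤ P.deg k ∧ i ∈ (P.slice k m).indices := by
  simp [mem_indices, Fin.forall_iff_succAbove k, slice]

lemma eval_insertNth (P : BernsteinPoly (d + 1)) (k : Fin (d + 1)) (t : ℝ) (y : Fin d → ℝ) :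
    P.eval (k.insertNth (α := fun _ => ℝ) t y) = ∑ l ∈ Finset.range (P.deg k + 1),
      (P.slice k l).eval y * bernsteinBasis (P.deg k) (P.lo k) (P.hi k) l t := by
  unfold eval
  simp only [Finset.sum_mul]
  rw [show (∑ l ∈ Finset.range (P.deg k + 1), ∑ i ∈ (P.slice k l).indices, _) =
    ∑ l ∈ Finset.range (P.deg k + 1), ∑ i ∈ (P.slice k 0).indices, _ from rfl,
    ← Finset.sum_product']
  refine Finset.sum_bij' (fun i _ => (i k, k.removeNth i))
    (fun p _ => k.insertNth (α := fun _ => ℕ) p.1 p.2) ?_ ?_ ?_ ?_ ?_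
  · intro i hi
    rw [← Fin.insertNth_self_removeNth k i, insertNth_mem_indices (m := 0)] at hi
    simpa [Nat.lt_succ_iff] using hi
  · intro p hp
    simpa [insertNth_mem_indices (m := 0), Nat.lt_succ_iff] using hp
  · intro i _
    simp
  · intro p _
    simp
  · intro i _
    rw [Fin.prod_univ_succAbove _ k]
    simp only [slice, Fin.insertNth_apply_same, Fin.insertNth_apply_succAbove,
      Fin.insertNth_self_removeNth, Fin.removeNth]
    ring

/-- The coordinate, in the direction `k`, of the points of the lower or upper face. -/
def faceCoord (P : BernsteinPoly d) (k : Fin d) (up : Bool) : ℝ := if up then P.hi k else P.lo k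

lemma eval_face (P : BernsteinPoly (d + 1)) (k : Fin (d + 1)) (up : Bool) (y : Fin d → ℝ) :
    (P.face k up).eval y = P.eval (k.insertNth (α := fun _ => ℝ) (P.faceCoord k up) y) := by
  rw [eval_insertNth, face_eq_slice]
  cases up
  · rw [Finset.sum_eq_single 0]
    · simp [faceCoord, bernsteinBasis_left (P.lo_lt_hi k)]
    · intro l hl h0
      simp [faceCoord, bernsteinBasis_left (P.lo_lt_hi k) (Finset.mem_range_succ_iff.1 hl), h0]
    · simp
  · rw [Finset.sum_eq_single (P.deg k)]
    · simp [faceCoord, bernsteinBasis_right (P.lo_lt_hi k)]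
    · intro l hl h0
      simp [faceCoord, bernsteinBasis_right (P.lo_lt_hi k) (Finset.mem_range_succ_iff.1 hl), h0]
    · simp

lemma faceCoord_mem (P : BernsteinPoly d) (k : Fin d) (up : Bool) :
    P.faceCoord k up ∈ Icc (P.lo k) (P.hi k) := by
  have := (P.lo_lt_hi k).le
  cases up <;> simp [faceCoord, this]

lemma insertNth_mem_box {P : BernsteinPoly (d + 1)} {k : Fin (d + 1)} {up : Bool} {t : ℝ}
    {y : Fin d → ℝ} : k.insertNth (α := fun _ => ℝ) t y ∈ P.box ↔
      t ∈ Icc (P.lo k) (P.hi k) ∧ y ∈ (P.face k up).box := by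
  simp [mem_box, Fin.forall_iff_succAbove k, face]

lemma removeNth_mem_box {P : BernsteinPoly (d + 1)} {x : Fin (d + 1) → ℝ} (hx : x ∈ P.box)
    (k : Fin (d + 1)) (up : Bool) : k.removeNth x ∈ (P.face k up).box := by
  rw [← Fin.insertNth_self_removeNth k x, insertNth_mem_box (up := up)] at hx
  exact hx.2

lemma eval_slice_le_eval_slice (P : BernsteinPoly (d + 1)) (k : Fin (d + 1)) {l m : ℕ}
    (h : ∀ i ∈ (P.slice k l).indices, (P.slice k l).coeff i ≤ (P.slice k m).coeff i)
    {y : Fin d → ℝ} (hy : y ∈ (P.slice k l).box) :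
    (P.slice k l).eval y ≤ (P.slice k m).eval y :=
  Finset.sum_le_sum fun i hi =>
    mul_le_mul_of_nonneg_right (h i hi) ((P.slice k l).prod_bernsteinBasis_nonneg i hy)

lemma insertNth_add_single (k : Fin (d + 1)) (l : ℕ) (i : Fin d → ℕ) :
    k.insertNth (α := fun _ => ℕ) l i + Pi.single k 1 =
      k.insertNth (α := fun _ => ℕ) (l + 1) i := by
  funext j
  refine Fin.succAboveCases k ?_ (fun j => ?_) j <;> simp

/-- A polynomial that is coefficient monotone in the direction `k` is a monotone function of `x_k`,
in the same sense for all values of the other variables. -/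
lemma CoeffMonotone.monotoneOn_or_antitoneOn {P : BernsteinPoly (d + 1)} {k : Fin (d + 1)}
    (h : P.CoeffMonotone k) :
    (∀ y ∈ (P.face k false).box, MonotoneOn
      (fun t => P.eval (k.insertNth (α := fun _ => ℝ) t y)) (Icc (P.lo k) (P.hi k))) ∨
    (∀ y ∈ (P.face k false).box, AntitoneOn
      (fun t => P.eval (k.insertNth (α := fun _ => ℝ) t y)) (Icc (P.lo k) (P.hi k))) := by
  refine h.imp (fun h y hy => ?_) (fun h y hy => ?_)
  · simp only [eval_insertNth]
    refine monotoneOn_sum_bernsteinBasis (P.lo_lt_hi k) _ (fun l => (P.slice k l).eval y)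
      fun l hl => P.eval_slice_le_eval_slice k (fun i hi => ?_) hy
    have := h (k.insertNth (α := fun _ => ℕ) l i) (insertNth_mem_indices.2 ⟨hl.le, hi⟩) (by simpa)
    rwa [insertNth_add_single] at this
  · simp only [eval_insertNth]
    have := monotoneOn_sum_bernsteinBasis (P.lo_lt_hi k) (P.deg k)
      (fun l => -(P.slice k l).eval y) fun l hl => by
        refine neg_le_neg (P.eval_slice_le_eval_slice k (fun i hi => ?_) hy)
        have := h (k.insertNth (α := fun _ => ℕ) l i)
          (insertNth_mem_indices.2 ⟨hl.le, hi⟩) (by simpa)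
        rwa [insertNth_add_single] at this
    simp only [neg_mul, Finset.sum_neg_distrib] at this
    simpa using this.neg

/-! ### Faces of faces -/

/-- Restricting in two directions commutes, up to the renumbering of the directions. -/
lemma face_face (P : BernsteinPoly (d + 2)) (k : Fin (d + 2)) (j : Fin (d + 1)) (a b : Bool) :
    (P.face k a).face j b = (P.face (k.succAbove j) b).face (j.predAbove k) a := by
  have h : ∀ m, (k.succAbove (j.succAbove m)) =
      (k.succAbove j).succAbove ((j.predAbove k).succAbove m) := fun m =>
    (Fin.succAbove_succAbove_succAbove_predAbove k j m).symm
  have h' : (k.succAbove j).succAbove (j.predAbove k) = k := Fin.succAbove_succAbove_predAbove k j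
  have hins : ∀ (u v : ℕ) (i : Fin d → ℕ),
      k.insertNth (α := fun _ => ℕ) u (j.insertNth (α := fun _ => ℕ) v i) =
      (k.succAbove j).insertNth (α := fun _ => ℕ) v
        ((j.predAbove k).insertNth (α := fun _ => ℕ) u i) := by
    intro u v i
    rw [Fin.insertNth_eq_iff]
    refine ⟨?_, ?_⟩
    · have := congrArg ((k.succAbove j).insertNth (α := fun _ => ℕ) v
        ((j.predAbove k).insertNth (α := fun _ => ℕ) u i)) h'
      rw [← this, Fin.insertNth_apply_succAbove, Fin.insertNth_apply_same]
    · funext m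
      simp only [Fin.removeNth]
      refine Fin.succAboveCases j ?_ (fun m => ?_) m
      · simp
      · rw [h]
        simp
  simp only [face, hins, h, h']

lemma CoeffMonotone.face {P : BernsteinPoly (d + 2)} {k : Fin (d + 2)} {j : Fin (d + 1)}
    (h : P.CoeffMonotone (k.succAbove j)) (up : Bool) : (P.face k up).CoeffMonotone j := by
  have h1 : ∀ (l : ℕ) (i : Fin (d + 1) → ℕ),
      k.insertNth (α := fun _ => ℕ) l i + Pi.single (k.succAbove j) 1 =
        k.insertNth (α := fun _ => ℕ) l (i + Pi.single j 1) := by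
    intro l i
    funext m
    refine Fin.succAboveCases k ?_ (fun m => ?_) m
    · simp [(Fin.succAbove_ne k j).symm]
    · simp [Pi.single_apply]
  have hup : (if up then P.deg k else 0) ≤ P.deg k := by cases up <;> simp
  refine h.imp (fun h i hi hij => ?_) (fun h i hi hij => ?_)
  · have := h (k.insertNth (α := fun _ => ℕ) (if up then P.deg k else 0) i)
      (insertNth_mem_indices.2 ⟨hup, hi⟩) (by simpa [BernsteinPoly.face] using hij)
    rwa [h1] at this
  · have := h (k.insertNth (α := fun _ => ℕ) (if up then P.deg k else 0) i)
      (insertNth_mem_indices.2 ⟨hup, hi⟩) (by simpa [BernsteinPoly.face] using hij)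
    rwa [h1] at this

end BernsteinPoly

/-! ### Sign sets of simply connected polynomials -/

open BernsteinPoly

variable {d : ℕ} {σ : SignEvaluator}

lemma signOf_ne_zero (s : Bool) : signOf s ≠ 0 := by cases s <;> decide

lemma signOf_injective : Function.Injective signOf := by decide

lemma signOf_mem_unionZero {a b : Set SignType} {s : Bool} (h : signOf s ∈ unionZero a b) :
    signOf s ∈ a ∨ signOf s ∈ b := by
  unfold unionZero at h
  split_ifs at h with hab
  · rw [← mem_union, hab]
    cases s <;> simp [signOf]
  · exact h

lemma exists_sign_eq_signOf {r : ℝ} (hr : r ≠ 0) : ∃ s, SignType.sign r = signOf s := by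
  rcases hr.lt_or_gt with h | h
  · exact ⟨false, sign_neg h⟩
  · exact ⟨true, sign_pos h⟩

/-- Being simply connected passes to all faces, not only to those in the direction of
monotonicity. This is where face consistency of the sign evaluation is used. -/
lemma IsSimplyConnected.face (hf : IsFaceConsistent σ) {P : BernsteinPoly (d + 1)}
    (hP : IsSimplyConnected σ P) (k : Fin (d + 1)) (up : Bool) :
    IsSimplyConnected σ (P.face k up) := by
  induction d with
  | zero => trivial
  | succ d ih =>
    rcases hP with hP | hP | ⟨i, hi, h0, h1⟩
    · exact Or.inl ((hf P k up).1 hP)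
    · exact Or.inr (Or.inl ((hf P k up).2 hP))
    · rcases eq_or_ne i k with rfl | hik
      · cases up <;> assumption
      · obtain ⟨j, rfl⟩ := Fin.exists_succAbove_eq hik
        refine Or.inr (Or.inr ⟨j, hi.face up, ?_, ?_⟩) <;> rw [face_face]
        · exact ih h0 _
        · exact ih h1 _

/-- On a simply connected polynomial, the sign evaluation reports a strict sign only if this sign
occurs: this is exact in dimension zero, and monotonicity reduces it to the faces. -/
lemma IsSimplyConnected.exists_sign_eq (hσ : IsSignEvaluation σ) {P : BernsteinPoly d}
    (hP : IsSimplyConnected σ P) {s : Bool} (hs : signOf s ∈ σ P) :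
    ∃ x ∈ P.box, SignType.sign (P.eval x) = signOf s := by
  induction d with
  | zero =>
    have h := hσ.sign_mem P _ P.lo_mem_box
    rw [hσ.of_dim_zero P, mem_singleton_iff] at h hs
    exact ⟨_, P.lo_mem_box, h.trans hs.symm⟩
  | succ d ih =>
    rcases hP with hP | hP | ⟨k, hk, h0, h1⟩
    · have h := hσ.sign_mem P _ P.lo_mem_box
      rw [hP, mem_singleton_iff] at h hs
      exact ⟨_, P.lo_mem_box, h.trans hs.symm⟩
    · have h := hσ.sign_mem P _ P.lo_mem_box
      rw [hP, mem_singleton_iff] at h hs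
      exact ⟨_, P.lo_mem_box, h.trans hs.symm⟩
    · have key : ∃ up, ∃ y ∈ (P.face k up).box,
          SignType.sign ((P.face k up).eval y) = signOf s := by
        rcases signOf_mem_unionZero (hσ.of_monotone P k hk hs) with h | h
        · exact ⟨false, ih h0 h⟩
        · exact ⟨true, ih h1 h⟩
      obtain ⟨up, y, hy, hys⟩ := key
      refine ⟨_, insertNth_mem_box.2 ⟨P.faceCoord_mem k up, hy⟩, ?_⟩
      rwa [eval_face] at hys

/-- The points of the cell where the polynomial has the strict sign `s`. -/
def signSet (P : BernsteinPoly d) (s : Bool) : Set (Fin d → ℝ) :=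
  {x | x ∈ P.box ∧ SignType.sign (P.eval x) = signOf s}

lemma sign_eq_signOf_of_le {s : Bool} {a b : ℝ} (h : SignType.sign a = signOf s)
    (hab : if s then a ≤ b else b ≤ a) : SignType.sign b = signOf s := by
  cases s
  · simp only [signOf, Bool.false_eq_true, if_false, sign_eq_neg_one_iff] at *
    linarith
  · simp only [signOf, if_true, sign_eq_one_iff] at *
    linarith

/-- Along a direction of coefficient monotonicity, the points of a given strict sign can all be
moved to the same one of the two faces without leaving the set of this sign. -/
lemma exists_face_joinedIn {P : BernsteinPoly (d + 1)} {k : Fin (d + 1)} (h : P.CoeffMonotone k)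
    (s : Bool) : ∃ up, ∀ x ∈ signSet P s,
      JoinedIn (signSet P s) x
        (k.insertNth (α := fun _ => ℝ) (P.faceCoord k up) (k.removeNth x)) := by
  have key : ∃ up, ∀ y ∈ (P.face k false).box, ∀ t ∈ Icc (P.lo k) (P.hi k),
      ∀ u ∈ uIcc t (P.faceCoord k up),
        SignType.sign (P.eval (k.insertNth (α := fun _ => ℝ) t y)) = signOf s →
        SignType.sign (P.eval (k.insertNth (α := fun _ => ℝ) u y)) = signOf s := by
    -- towards the upper face if `P` is increasing and `s` is positive, or `P` is decreasing and `s`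
    -- is negative; towards the lower face otherwise
    rcases h.monotoneOn_or_antitoneOn with hm | hm
    · refine ⟨s, fun y hy t ht u hu hs => sign_eq_signOf_of_le hs ?_⟩
      cases s
      · rw [uIcc_of_ge (show P.faceCoord k false ≤ t from ht.1)] at hu
        exact hm y hy ⟨hu.1, hu.2.trans ht.2⟩ ht hu.2
      · rw [uIcc_of_le (show t ≤ P.faceCoord k true from ht.2)] at hu
        exact hm y hy ht ⟨ht.1.trans hu.1, hu.2⟩ hu.1
    · refine ⟨!s, fun y hy t ht u hu hs => sign_eq_signOf_of_le hs ?_⟩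
      cases s
      · rw [Bool.not_false, uIcc_of_le (show t ≤ P.faceCoord k true from ht.2)] at hu
        exact hm y hy ht ⟨ht.1.trans hu.1, hu.2⟩ hu.1
      · rw [Bool.not_true, uIcc_of_ge (show P.faceCoord k false ≤ t from ht.1)] at hu
        exact hm y hy ⟨hu.1, hu.2.trans ht.2⟩ ht hu.2
  obtain ⟨up, hup⟩ := key
  refine ⟨up, fun x hx => ?_⟩
  obtain ⟨hxb, hxs⟩ := hx
  have hy := removeNth_mem_box hxb k false
  have hxk : x k ∈ Icc (P.lo k) (P.hi k) := mem_box.1 hxb k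
  have hc := P.faceCoord_mem k up
  have hj : JoinedIn (uIcc (x k) (P.faceCoord k up)) (x k) (P.faceCoord k up) :=
    JoinedIn.of_segment_subset (segment_eq_uIcc _ _).subset
  have hcont : Continuous fun t : ℝ => k.insertNth (α := fun _ => ℝ) t (k.removeNth x) :=
    Continuous.finInsertNth (A := fun _ => ℝ) k continuous_id continuous_const
  have := hj.map hcont
  simp only [Fin.insertNth_self_removeNth] at this
  refine this.mono ?_
  rintro _ ⟨u, hu, rfl⟩
  refine ⟨insertNth_mem_box.2 ⟨?_, hy⟩, hup _ hy _ hxk u hu (by simpa using hxs)⟩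
  exact (convex_Icc (P.lo k) (P.hi k)).ordConnected.uIcc_subset hxk hc hu

/-- The positive and the negative set of a simply connected polynomial are path connected. -/
lemma IsSimplyConnected.joinedIn (hσ : IsSignEvaluation σ) {P : BernsteinPoly d}
    (hP : IsSimplyConnected σ P) {s : Bool} {x y : Fin d → ℝ} (hx : x ∈ signSet P s)
    (hy : y ∈ signSet P s) : JoinedIn (signSet P s) x y := by
  have const : ∀ {d : ℕ} {P : BernsteinPoly d} {x y : Fin d → ℝ} {ε : SignType}, σ P = {ε} →
      x ∈ signSet P s → y ∈ signSet P s → JoinedIn (signSet P s) x y := by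
    intro d P x y ε hP hx hy
    have hε : ∀ z ∈ P.box, SignType.sign (P.eval z) = ε := fun z hz => by
      simpa [hP] using hσ.sign_mem P z hz
    refine JoinedIn.of_segment_subset fun z hz => ?_
    have hz' : z ∈ P.box := (convex_Icc P.lo P.hi).segment_subset hx.1 hy.1 hz
    exact ⟨hz', (hε z hz').trans ((hε x hx.1).symm.trans hx.2)⟩
  induction d with
  | zero => exact const (hσ.of_dim_zero P) hx hy
  | succ d ih =>
    rcases hP with hP | hP | ⟨k, hk, h0, h1⟩
    · exact const hP hx hy
    · exact const hP hx hy
    · obtain ⟨up, hup⟩ := exists_face_joinedIn hk s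
      have hjx := hup x hx
      have hjy := hup y hy
      refine hjx.trans (JoinedIn.trans ?_ hjy.symm)
      have hface : IsSimplyConnected σ (P.face k up) := by cases up <;> assumption
      have hmem : ∀ z, k.insertNth (α := fun _ => ℝ) (P.faceCoord k up) z ∈ signSet P s ↔
          z ∈ signSet (P.face k up) s := fun z => by
        simp only [signSet, mem_ofPred_eq, eval_face, insertNth_mem_box (up := up),
          P.faceCoord_mem k up, true_and]
      have := ih hface ((hmem _).1 hjx.target_mem) ((hmem _).1 hjy.target_mem)
      have hcont : Continuous fun z : Fin d → ℝ =>
          k.insertNth (α := fun _ => ℝ) (P.faceCoord k up) z :=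
        Continuous.finInsertNth (A := fun _ => ℝ) k continuous_const continuous_id
      refine (this.map hcont).mono ?_
      rintro _ ⟨z, hz, rfl⟩
      exact (hmem z).2 hz

/-! ### The leaf cells of the subdivision tree -/

lemma CellTree.finite_leaves (T : CellTree d) : T.leaves.Finite := by
  induction T with
  | leaf P => exact finite_singleton P
  | node ch ih => exact finite_iUnion ih

/-- Induction on the subdivision tree: a relation between cells holds between the root and every
leaf cell if it is reflexive and inherited from a subcell by the cell. -/
lemma leaves_subdivide_induction {R : BernsteinPoly d → BernsteinPoly d → Prop}
    (refl : ∀ P, R P P) (step : ∀ P s U, R (P.child s) U → R P U) :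
    ∀ (r : ℕ) (P U : BernsteinPoly d), U ∈ (subdivide σ r P).leaves → R P U
  | 0, P, U, hU => by
    obtain rfl : U = P := hU
    exact refl U
  | r + 1, P, U, hU => by
    rw [subdivide] at hU
    split_ifs at hU with h
    · obtain rfl : U = P := hU
      exact refl U
    · obtain ⟨s, hs⟩ := mem_iUnion.1 hU
      exact step P s U (leaves_subdivide_induction refl step r _ U hs)

lemma eval_of_mem_leaves {r : ℕ} {P U : BernsteinPoly d} (hU : U ∈ (subdivide σ r P).leaves) :
    U.eval = P.eval :=
  leaves_subdivide_induction (R := fun P U => U.eval = P.eval) (fun _ => rfl)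
    (fun P s _ h => h.trans (funext (P.eval_child s))) r P U hU

/-- The half-open interval with endpoints `a < b` that contains, with a point `t`, also the points
near `t` on the right (`e = true`) or on the left (`e = false`) of `t`. -/
def halfOpen (a b : ℝ) (e : Bool) : Set ℝ := if e then Ico a b else Ioc a b

/-- The cell contains `x` and all points near `x` in the open orthant at `x` given by `ε`, where
`ε j` tells whether the coordinate `j` increases. In contrast to a point, such a germ of an orthant
lies in a single cell of a subdivision. -/
def ContainsGerm (P : BernsteinPoly d) (x : Fin d → ℝ) (ε : Fin d → Bool) : Prop :=
  ∀ j, x j ∈ halfOpen (P.lo j) (P.hi j) (ε j)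

lemma mem_halfOpen_true {a b t : ℝ} : t ∈ halfOpen a b true ↔ a ≤ t ∧ t < b := Iff.rfl

lemma mem_halfOpen_false {a b t : ℝ} : t ∈ halfOpen a b false ↔ a < t ∧ t ≤ b := by
  simp [halfOpen]

lemma halfOpen_subset_Icc {a b : ℝ} {e : Bool} : halfOpen a b e ⊆ Icc a b := by
  cases e
  · exact Ioc_subset_Icc_self
  · exact Ico_subset_Icc_self

lemma ContainsGerm.mem_box {P : BernsteinPoly d} {x : Fin d → ℝ} {ε : Fin d → Bool}
    (h : ContainsGerm P x ε) : x ∈ P.box :=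
  BernsteinPoly.mem_box.2 fun j => halfOpen_subset_Icc (h j)

lemma exists_containsGerm {P : BernsteinPoly d} {x : Fin d → ℝ} (hx : x ∈ P.box) :
    ∃ ε, ContainsGerm P x ε := by
  refine ⟨fun j => decide (x j < P.hi j), fun j => ?_⟩
  have h := BernsteinPoly.mem_box.1 hx j
  have h' := P.lo_lt_hi j
  by_cases hj : x j < P.hi j
  · simp only [hj, decide_true]
    exact ⟨h.1, hj⟩
  · simp only [hj, decide_false]
    exact mem_halfOpen_false.2 ⟨by linarith, h.2⟩

/-- Exactly one half of an interval contains a given germ of the interval. -/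
lemma containsGerm_child {P : BernsteinPoly d} {s : Fin d → Bool} {x : Fin d → ℝ}
    {ε : Fin d → Bool} : ContainsGerm (P.child s) x ε ↔ ContainsGerm P x ε ∧
      ∀ j, s j = true ↔ x j ∈ halfOpen ((P.lo j + P.hi j) / 2) (P.hi j) (ε j) := by
  unfold ContainsGerm
  rw [← forall_and]
  refine forall_congr' fun j => ?_
  have h := P.lo_lt_hi j
  rcases hs : s j with _ | _ <;> rcases he : ε j with _ | _ <;>
    simp only [child, hs, mem_halfOpen_true, mem_halfOpen_false, Bool.false_eq_true, if_true,
      if_false, true_iff, false_iff, not_and, not_le, not_lt] <;> constructor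
  · rintro ⟨h1, h2⟩
    exact ⟨⟨h1, by linarith⟩, fun h3 => by linarith⟩
  · rintro ⟨⟨h1, h2⟩, h3⟩
    exact ⟨h1, not_lt.1 fun h4 => (h3 h4).not_ge h2⟩
  · rintro ⟨h1, h2⟩
    exact ⟨⟨h1, by linarith⟩, fun h3 => by linarith⟩
  · rintro ⟨⟨h1, h2⟩, h3⟩
    exact ⟨h1, not_le.1 fun h4 => (h3 h4).not_gt h2⟩
  · rintro ⟨h1, h2⟩
    exact ⟨⟨by linarith, h2⟩, h1, h2⟩
  · rintro ⟨⟨h1, h2⟩, h3⟩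
    exact h3
  · rintro ⟨h1, h2⟩
    exact ⟨⟨by linarith, h2⟩, h1, h2⟩
  · rintro ⟨⟨h1, h2⟩, h3⟩
    exact h3

lemma ContainsGerm.of_mem_leaves {r : ℕ} {P U : BernsteinPoly d} {x : Fin d → ℝ}
    {ε : Fin d → Bool} (hU : U ∈ (subdivide σ r P).leaves) (h : ContainsGerm U x ε) :
    ContainsGerm P x ε :=
  leaves_subdivide_induction (R := fun P U => ContainsGerm U x ε → ContainsGerm P x ε)
    (fun _ => id) (fun _ _ _ h' hU => (containsGerm_child.1 (h' hU)).1) r P U hU h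

lemma box_subset_of_mem_leaves {r : ℕ} {P U : BernsteinPoly d}
    (hU : U ∈ (subdivide σ r P).leaves) : U.box ⊆ P.box := fun _ hx =>
  let ⟨_, hε⟩ := exists_containsGerm hx
  (hε.of_mem_leaves hU).mem_box

lemma existsUnique_leaf_containsGerm {x : Fin d → ℝ} {ε : Fin d → Bool} :
    ∀ (r : ℕ) (P : BernsteinPoly d), ContainsGerm P x ε →
      ∃! U, U ∈ (subdivide σ r P).leaves ∧ ContainsGerm U x ε
  | 0, P, h => ⟨P, ⟨rfl, h⟩, fun _ hU => hU.1⟩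
  | r + 1, P, h => by
    classical
    rw [subdivide]
    split_ifs
    · exact ⟨P, ⟨rfl, h⟩, fun _ hU => hU.1⟩
    · set s : Fin d → Bool := fun j =>
        decide (x j ∈ halfOpen ((P.lo j + P.hi j) / 2) (P.hi j) (ε j)) with hs
      obtain ⟨U, ⟨hU, hUε⟩, huniq⟩ := existsUnique_leaf_containsGerm r (P.child s)
        (containsGerm_child.2 ⟨h, fun j => by simp [hs]⟩)
      refine ⟨U, ⟨mem_iUnion.2 ⟨s, hU⟩, hUε⟩, ?_⟩
      rintro V ⟨hV, hVε⟩
      obtain ⟨s', hs'⟩ := mem_iUnion.1 hV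
      have h' := (containsGerm_child.1 (hVε.of_mem_leaves hs')).2
      obtain rfl : s' = s := funext fun j => by
        rw [Bool.eq_iff_iff, h' j, hs, decide_eq_true_iff]
      exact huniq V ⟨hs', hVε⟩

lemma eq_of_containsGerm {r : ℕ} {P U V : BernsteinPoly d} {x : Fin d → ℝ} {ε : Fin d → Bool}
    (hU : U ∈ (subdivide σ r P).leaves) (hV : V ∈ (subdivide σ r P).leaves)
    (hUε : ContainsGerm U x ε) (hVε : ContainsGerm V x ε) : U = V :=
  (existsUnique_leaf_containsGerm r P (hUε.of_mem_leaves hU)).unique ⟨hU, hUε⟩ ⟨hV, hVε⟩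

/-- The cell `U` lies at level `ℓ` of the dyadic grid of the cell `P`. -/
def IsDyadic (P : BernsteinPoly d) (ℓ : ℕ) (U : BernsteinPoly d) : Prop :=
  ∀ j, ∃ a : ℤ, U.lo j = P.lo j + a * ((P.hi j - P.lo j) / 2 ^ ℓ) ∧
    U.hi j = P.lo j + (a + 1) * ((P.hi j - P.lo j) / 2 ^ ℓ)

lemma exists_isDyadic {r : ℕ} {P U : BernsteinPoly d} (hU : U ∈ (subdivide σ r P).leaves) :
    ∃ ℓ, IsDyadic P ℓ U := by
  refine leaves_subdivide_induction (R := fun P U => ∃ ℓ, IsDyadic P ℓ U) ?_ ?_ r P U hU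
  · exact fun P => ⟨0, fun j => ⟨0, by simp, by simp⟩⟩
  · rintro P s U ⟨ℓ, h⟩
    refine ⟨ℓ + 1, fun j => ?_⟩
    obtain ⟨a, ha, hb⟩ := h j
    rw [ha, hb]
    rcases hs : s j with _ | _ <;>
      simp only [child, hs, if_true, if_false, Bool.false_eq_true, pow_succ]
    · refine ⟨a, ?_, ?_⟩ <;> field_simp <;> ring
    · refine ⟨a + 2 ^ ℓ, ?_, ?_⟩ <;> push_cast <;> field_simp <;> ring

/-- Two dyadic intervals that contain the same germ are nested. -/
lemma dyadic_nested {o h t : ℝ} (hh : 0 < h) {a b : ℤ} {m : ℕ} {e : Bool}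
    (ha : t ∈ halfOpen (o + a * h) (o + (a + 1) * h) e)
    (hb : t ∈ halfOpen (o + b * (2 ^ m * h)) (o + (b + 1) * (2 ^ m * h)) e) :
    o + b * (2 ^ m * h) ≤ o + a * h ∧ o + (a + 1) * h ≤ o + (b + 1) * (2 ^ m * h) := by
  -- the endpoints, in units of `h`, are integers, so strict inequalities improve by one
  have key : ((b * 2 ^ m : ℤ) : ℝ) * h < ((a + 1 : ℤ) : ℝ) * h ∧
      ((a : ℤ) : ℝ) * h < (((b + 1) * 2 ^ m : ℤ) : ℝ) * h := by
    push_cast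
    cases e
    · rw [mem_halfOpen_false] at ha hb
      constructor <;> nlinarith
    · rw [mem_halfOpen_true] at ha hb
      constructor <;> nlinarith
  have h1 : b * 2 ^ m ≤ a := Int.lt_add_one_iff.1 (by
    exact_mod_cast lt_of_mul_lt_mul_right key.1 hh.le)
  have h2 : a + 1 ≤ (b + 1) * 2 ^ m := Int.add_one_le_iff.2 (by
    exact_mod_cast lt_of_mul_lt_mul_right key.2 hh.le)
  have h1' : (b : ℝ) * 2 ^ m ≤ a := by exact_mod_cast h1
  have h2' : (a : ℝ) + 1 ≤ (b + 1) * 2 ^ m := by exact_mod_cast h2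
  constructor <;> nlinarith

/-- In every direction in which `U` and `V` contain a common germ, the side of `U` lies in the side
of `V`. -/
def NestedSides (U V : BernsteinPoly d) : Prop :=
  ∀ j t e, t ∈ halfOpen (U.lo j) (U.hi j) e → t ∈ halfOpen (V.lo j) (V.hi j) e →
    V.lo j ≤ U.lo j ∧ U.hi j ≤ V.hi j

lemma IsDyadic.nestedSides {P U V : BernsteinPoly d} {ℓ m : ℕ} (hU : IsDyadic P ℓ U)
    (hV : IsDyadic P m V) (h : m ≤ ℓ) : NestedSides U V := by
  intro j t e htU htV
  obtain ⟨a, ha, ha'⟩ := hU j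
  obtain ⟨b, hb, hb'⟩ := hV j
  have hw := P.lo_lt_hi j
  have hsize : (P.hi j - P.lo j) / 2 ^ m = 2 ^ (ℓ - m) * ((P.hi j - P.lo j) / 2 ^ ℓ) := by
    rw [← Nat.sub_add_cancel h, Nat.add_sub_cancel, pow_add]
    field_simp
  rw [hsize] at hb hb'
  rw [ha, ha'] at htU ⊢
  rw [hb, hb'] at htV ⊢
  exact dyadic_nested (div_pos (sub_pos.2 hw) (by positivity)) htU htV

lemma nestedSides_or_nestedSides {r : ℕ} {P U V : BernsteinPoly d}
    (hU : U ∈ (subdivide σ r P).leaves) (hV : V ∈ (subdivide σ r P).leaves) :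
    NestedSides U V ∨ NestedSides V U := by
  obtain ⟨ℓ, hℓ⟩ := exists_isDyadic hU
  obtain ⟨m, hm⟩ := exists_isDyadic hV
  exact (le_total m ℓ).imp (hℓ.nestedSides hm) (hm.nestedSides hℓ)

/-- Two leaf cells that contain neighbouring germs at `x` coincide or meet along a face through
`x`. -/
lemma eq_or_meetsAlong {r : ℕ} {P U V : BernsteinPoly d} {x : Fin d → ℝ} {ε δ : Fin d → Bool}
    {k : Fin d} (hU : U ∈ (subdivide σ r P).leaves) (hV : V ∈ (subdivide σ r P).leaves)
    (hUV : NestedSides U V) (hUε : ContainsGerm U x ε) (hVδ : ContainsGerm V x δ)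
    (hk : δ k = !ε k) (hj : ∀ j ≠ k, δ j = ε j) :
    U = V ∨ ∃ up, MeetsAlong U V k up ∧ x k = U.faceCoord k up := by
  -- a cell with `x k` in the interior of its side contains both germs
  by_cases hUδ : x k ∈ halfOpen (U.lo k) (U.hi k) (δ k)
  · refine Or.inl (eq_of_containsGerm hU hV (fun j => ?_) hVδ)
    rcases eq_or_ne j k with rfl | h
    · exact hUδ
    · exact hj j h ▸ hUε j
  by_cases hVε : x k ∈ halfOpen (V.lo k) (V.hi k) (ε k)
  · refine Or.inl (eq_of_containsGerm hU hV hUε fun j => ?_)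
    rcases eq_or_ne j k with rfl | h
    · exact hVε
    · exact hj j h ▸ hVδ j
  have hside : ∀ j, j ≠ k → V.lo j ≤ U.lo j ∧ U.hi j ≤ V.hi j := fun j h =>
    hUV j (x j) (ε j) (hUε j) (hj j h ▸ hVδ j)
  have h1 := hUε k
  have h2 := hVδ k
  rw [hk] at hUδ h2
  rcases he : ε k with _ | _ <;> rw [he] at hUδ h2 hVε h1
  · have e1 : x k = U.hi k := le_antisymm h1.2 (not_lt.1 fun h => hUδ ⟨h1.1.le, h⟩)
    have e2 : x k = V.lo k := le_antisymm (not_lt.1 fun h => hVε ⟨h, h2.2.le⟩) h2.1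
    exact Or.inr ⟨true, ⟨e1.symm.trans e2, hside⟩, e1⟩
  · have e1 : x k = U.lo k := le_antisymm (not_lt.1 fun h => hUδ ⟨h, h1.2.le⟩) h1.1
    have e2 : x k = V.hi k := le_antisymm h2.2 (not_lt.1 fun h => hVε ⟨h2.1.le, h⟩)
    exact Or.inr ⟨false, ⟨e1.symm.trans e2, hside⟩, e1⟩

/-! ### Cell graphs and path components -/

variable {Λ : ℕ} {φ : BernsteinPoly (d + 1)} {s : Bool}

/-- If two leaf cells meet along a face on which the sign `s` occurs, they are joined by an edge. -/
lemma adj_of_meetsAlong (hσ : IsSignEvaluation σ) {U V : (subdivide σ Λ φ).leaves}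
    {x : Fin (d + 1) → ℝ} {k : Fin (d + 1)} {up : Bool} (h : MeetsAlong U.1 V.1 k up)
    (hxU : x ∈ U.1.box) (hxk : x k = U.1.faceCoord k up)
    (hx : SignType.sign (φ.eval x) = signOf s) : (cellGraph σ (subdivide σ Λ φ) s).Adj U V := by
  refine Or.inl ⟨k, up, h, ?_⟩
  have := hσ.sign_mem (U.1.face k up) _ (removeNth_mem_box hxU k up)
  rwa [eval_face, ← hxk, Fin.insertNth_self_removeNth, eval_of_mem_leaves U.2, hx] at this

/-- All leaf cells containing a point of the sign `s` lie in one connected component. The germs of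
orthants at the point are each contained in one leaf cell, and reversing one coordinate of a germ
leads to the same or to an adjacent leaf cell. -/
lemma reachable_of_mem_box (hσ : IsSignEvaluation σ) {U V : (subdivide σ Λ φ).leaves}
    {x : Fin (d + 1) → ℝ} (hU : x ∈ U.1.box) (hV : x ∈ V.1.box)
    (hx : SignType.sign (φ.eval x) = signOf s) :
    (cellGraph σ (subdivide σ Λ φ) s).Reachable U V := by
  classical
  obtain ⟨ε, hε⟩ := exists_containsGerm hU
  obtain ⟨δ, hδ⟩ := exists_containsGerm hV
  have hφε := hε.of_mem_leaves U.2
  have hφδ := hδ.of_mem_leaves V.2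
  have key : ∀ (S : Finset (Fin (d + 1))) (W : (subdivide σ Λ φ).leaves),
      ContainsGerm W.1 x (S.piecewise δ ε) → (cellGraph σ (subdivide σ Λ φ) s).Reachable U W := by
    intro S
    induction S using Finset.induction_on with
    | empty =>
      intro W hW
      rw [Finset.piecewise_empty] at hW
      rw [Subtype.ext (eq_of_containsGerm U.2 W.2 hε hW)]
    | insert k S hk ih =>
      intro W hW
      rw [Finset.piecewise_insert] at hW
      set g := S.piecewise δ ε with hg
      by_cases hkg : δ k = g k
      · rw [hkg, Function.update_eq_self] at hW
        exact ih W hW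
      · have hφg : ContainsGerm φ x g := fun j => by
          by_cases hj : j ∈ S
          · simpa [hg, hj] using hφδ j
          · simpa [hg, hj] using hφε j
        obtain ⟨W₀, ⟨hW₀, hW₀g⟩, -⟩ := existsUnique_leaf_containsGerm (σ := σ) Λ φ hφg
        have hgk : g k = !δ k := Bool.eq_not.2 (Ne.symm hkg)
        have hstep : W₀ = W.1 ∨
            (cellGraph σ (subdivide σ Λ φ) s).Adj ⟨W₀, hW₀⟩ W := by
          rcases nestedSides_or_nestedSides hW₀ W.2 with hn | hn
          · refine (eq_or_meetsAlong hW₀ W.2 hn hW₀g hW (k := k) (by simp [hgk])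
              (fun j hj => by simp [hj])).imp_right ?_
            rintro ⟨up, hm, hxk⟩
            exact adj_of_meetsAlong hσ (U := ⟨W₀, hW₀⟩) hm hW₀g.mem_box hxk hx
          · refine (eq_or_meetsAlong W.2 hW₀ hn hW hW₀g (k := k) (by simp [hgk])
              (fun j hj => by simp [hj])).imp Eq.symm ?_
            rintro ⟨up, hm, hxk⟩
            exact (adj_of_meetsAlong hσ (V := ⟨W₀, hW₀⟩) hm hW.mem_box hxk hx).symm
        have hreach := ih ⟨W₀, hW₀⟩ hW₀g
        rcases hstep with h | h
        · rwa [show W = ⟨W₀, hW₀⟩ from Subtype.ext h.symm]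
        · exact hreach.trans h.reachable
  exact key Finset.univ V (by simpa using hδ)

/-- Adjacent leaf cells have a common point of the sign in question. -/
lemma exists_mem_of_adj (hσ : IsSignEvaluation σ) (hf : IsFaceConsistent σ)
    (hsc : ∀ U ∈ (subdivide σ Λ φ).leaves, IsSimplyConnected σ U)
    {U V : (subdivide σ Λ φ).leaves} (h : (cellGraph σ (subdivide σ Λ φ) s).Adj U V) :
    ∃ x ∈ U.1.box, x ∈ V.1.box ∧ SignType.sign (φ.eval x) = signOf s := by
  have key : ∀ U V : (subdivide σ Λ φ).leaves, ∀ k up, MeetsAlong U.1 V.1 k up →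
      signOf s ∈ σ (U.1.face k up) →
      ∃ x ∈ U.1.box, x ∈ V.1.box ∧ SignType.sign (φ.eval x) = signOf s := by
    intro U V k up hm hs
    obtain ⟨y, hy, hys⟩ := ((hsc _ U.2).face hf k up).exists_sign_eq hσ hs
    rw [eval_face, eval_of_mem_leaves U.2] at hys
    have hmem := insertNth_mem_box.2 ⟨U.1.faceCoord_mem k up, hy⟩
    refine ⟨_, hmem, mem_box.2 fun j => ?_, hys⟩
    rcases eq_or_ne j k with rfl | hj
    · rw [Fin.insertNth_apply_same]
      have h1 := hm.1
      have h2 := V.1.lo_lt_hi j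
      cases up <;> simp only [faceCoord, if_true, if_false, Bool.false_eq_true] at h1 ⊢ <;>
        rw [h1] <;> exact ⟨by linarith, by linarith⟩
    · have h1 := mem_box.1 hmem j
      have h2 := hm.2 j hj
      exact ⟨h2.1.trans h1.1, h1.2.trans h2.2⟩
  rcases h with ⟨k, up, hm, hs⟩ | ⟨k, up, hm, hs⟩
  · exact key U V k up hm hs
  · obtain ⟨x, hV, hU, hx⟩ := key V U k up hm hs
    exact ⟨x, hU, hV, hx⟩

lemma signSet_subset_domain {P : BernsteinPoly d} : signSet P s ⊆ domain P := fun x hx =>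
  ⟨hx.1, fun h0 => signOf_ne_zero s (by rw [← hx.2, show P.eval x = 0 from h0, sign_zero])⟩

lemma exists_leaf_mem_box (σ : SignEvaluator) (Λ : ℕ) {x : Fin (d + 1) → ℝ} (hx : x ∈ φ.box) :
    ∃ U : (subdivide σ Λ φ).leaves, x ∈ U.1.box := by
  obtain ⟨ε, hε⟩ := exists_containsGerm hx
  obtain ⟨U, ⟨hU, hUε⟩, -⟩ := existsUnique_leaf_containsGerm (σ := σ) Λ φ hε
  exact ⟨⟨U, hU⟩, hUε.mem_box⟩

lemma sign_eval_somePath {P : BernsteinPoly d} {x y : Fin d → ℝ} (h : JoinedIn (domain P) x y)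
    (t u : unitInterval) :
    SignType.sign (P.eval (h.somePath t)) = SignType.sign (P.eval (h.somePath u)) := by
  have hc : Continuous fun t => SignType.sign (P.eval (h.somePath t)) := by
    refine continuous_iff_continuousAt.2 fun t => ?_
    exact (continuousAt_sign_of_ne_zero (h.somePath_mem t).2).comp
      (f := fun t => P.eval (h.somePath t))
      (P.continuous_eval.comp h.somePath.continuous).continuousAt
  exact PreconnectedSpace.constant inferInstance hc

lemma sign_eq_of_joinedIn {P : BernsteinPoly d} {x y : Fin d → ℝ}
    (h : JoinedIn (domain P) x y) : SignType.sign (P.eval x) = SignType.sign (P.eval y) := by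
  simpa using sign_eval_somePath h 0 1

/-- Inside each cell of a walk, the points of the sign `s` are joined by paths, and consecutive
cells have such a point in common. -/
lemma joinedIn_of_reachable (hσ : IsSignEvaluation σ) (hf : IsFaceConsistent σ)
    (hsc : ∀ U ∈ (subdivide σ Λ φ).leaves, IsSimplyConnected σ U)
    {U V : (subdivide σ Λ φ).leaves} (h : (cellGraph σ (subdivide σ Λ φ) s).Reachable U V)
    {x y : Fin (d + 1) → ℝ} (hxU : x ∈ U.1.box) (hyV : y ∈ V.1.box)
    (hx : SignType.sign (φ.eval x) = signOf s) (hy : SignType.sign (φ.eval y) = signOf s) :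
    JoinedIn (signSet φ s) x y := by
  have hcell : ∀ (W : (subdivide σ Λ φ).leaves) {x y : Fin (d + 1) → ℝ}, x ∈ W.1.box →
      y ∈ W.1.box → SignType.sign (φ.eval x) = signOf s →
      SignType.sign (φ.eval y) = signOf s → JoinedIn (signSet φ s) x y := by
    intro W x y hxW hyW hx hy
    have heval := eval_of_mem_leaves W.2
    refine ((hsc _ W.2).joinedIn hσ (s := s) ⟨hxW, by rwa [heval]⟩ ⟨hyW, by rwa [heval]⟩).mono ?_
    rintro z ⟨hz, hzs⟩
    exact ⟨box_subset_of_mem_leaves W.2 hz, by rwa [← heval]⟩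
  obtain ⟨w⟩ := h
  induction w generalizing x with
  | nil => exact hcell _ hxU hyV hx hy
  | cons hadj _ ih =>
    obtain ⟨z, hzU, hzW, hz⟩ := exists_mem_of_adj hσ hf hsc hadj
    exact (hcell _ hxU hzU hx hz).trans (ih hzW hyV hz)

/-- The leaf cells reachable from `U` and those not reachable from `U` cover a path of constant
sign by two disjoint closed sets. -/
lemma reachable_of_joinedIn (hσ : IsSignEvaluation σ) {U V : (subdivide σ Λ φ).leaves}
    {x y : Fin (d + 1) → ℝ} (hxU : x ∈ U.1.box) (hyV : y ∈ V.1.box)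
    (hx : SignType.sign (φ.eval x) = signOf s) (h : JoinedIn (domain φ) x y) :
    (cellGraph σ (subdivide σ Λ φ) s).Reachable U V := by
  set G := cellGraph σ (subdivide σ Λ φ) s
  have hsign : ∀ t, SignType.sign (φ.eval (h.somePath t)) = signOf s := by
    intro t
    simpa [hx] using sign_eval_somePath h t 0
  have hfin : Finite (subdivide σ Λ φ).leaves := (CellTree.finite_leaves _).to_subtype
  have hclosed : ∀ p : (subdivide σ Λ φ).leaves → Prop,
      IsClosed {t | ∃ W, p W ∧ h.somePath t ∈ W.1.box} := by
    intro p
    have : {t | ∃ W, p W ∧ h.somePath t ∈ W.1.box} =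
        ⋃ W : {W // p W}, h.somePath ⁻¹' W.1.1.box := by
      ext t
      simp
    rw [this]
    exact isClosed_iUnion_of_finite fun W => isClosed_Icc.preimage h.somePath.continuous
  have hclopen : IsClopen {t | ∃ W, G.Reachable U W ∧ h.somePath t ∈ W.1.box} := by
    refine ⟨hclosed _, ?_⟩
    rw [← isClosed_compl_iff]
    convert hclosed fun W => ¬ G.Reachable U W using 1
    ext t
    constructor
    · intro ht
      obtain ⟨W, hW⟩ := exists_leaf_mem_box σ Λ (h.somePath_mem t).1
      exact ⟨W, fun hr => ht ⟨W, hr, hW⟩, hW⟩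
    · rintro ⟨W, hr, hW⟩ ⟨W', hr', hW'⟩
      exact hr (hr'.trans (reachable_of_mem_box hσ hW' hW (hsign t)))
  have h1 : (1 : unitInterval) ∈ {t | ∃ W, G.Reachable U W ∧ h.somePath t ∈ W.1.box} := by
    rw [hclopen.eq_univ ⟨0, U, SimpleGraph.Reachable.refl U, by simpa using hxU⟩]
    trivial
  obtain ⟨W, hr, hW⟩ := h1
  rw [h.somePath.target] at hW
  exact hr.trans (reachable_of_mem_box hσ hW hyV (by simpa using hsign 1))

/-! ### Label tables -/

/-- The properties of the initial label table that persist when labels are created: equality of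
labels means membership in the same component of the same graph, and the cells incident to an edge
have labels. -/
structure IsValidTable (σ : SignEvaluator) (T : CellTree (d + 1)) (L : LabelTable T) : Prop where
  eq_iff : ∀ {U V s t a b}, L U s = some a → L V t = some b →
    (a = b ↔ s = t ∧ (cellGraph σ T s).Reachable U V)
  exists_of_adj : ∀ {U V s}, (cellGraph σ T s).Adj U V → ∃ a, L U s = some a

lemma IsInitialTable.isValidTable {T : CellTree (d + 1)} {L : LabelTable T}
    (h : IsInitialTable σ T L) : IsValidTable σ T L :=
  ⟨fun ha hb => h.2 _ _ _ _ _ _ ha hb, fun hadj => (h.1 _ _).2 ⟨_, hadj⟩⟩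

lemma exists_isInitialTable (σ : SignEvaluator) (T : CellTree (d + 1)) :
    ∃ L, IsInitialTable σ T L := by
  classical
  have : Finite T.leaves := (CellTree.finite_leaves T).to_subtype
  have hfin : ∀ s, Finite (cellGraph σ T s).ConnectedComponent := fun s =>
    Finite.of_surjective (cellGraph σ T s).connectedComponentMk Quot.mk_surjective
  obtain ⟨f, hf⟩ := exists_injective_nat (Σ s : Bool, (cellGraph σ T s).ConnectedComponent)
  refine ⟨fun U s => if ∃ V, (cellGraph σ T s).Adj U V then
    some (f ⟨s, (cellGraph σ T s).connectedComponentMk U⟩) else none, fun U s => ?_, ?_⟩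
  · by_cases h : ∃ V, (cellGraph σ T s).Adj U V <;> simp [h]
  · intro U V s t a b ha hb
    simp only [Option.ite_none_right_eq_some, Option.some.injEq] at ha hb
    rw [← ha.2, ← hb.2, hf.eq_iff]
    constructor
    · intro h
      obtain rfl : s = t := congrArg Sigma.fst h
      exact ⟨rfl, SimpleGraph.ConnectedComponent.exact (by simpa using h)⟩
    · rintro ⟨rfl, h⟩
      rw [SimpleGraph.ConnectedComponent.sound h]

/-- A new label does no harm: it goes to a cell without label, which is isolated in its graph, so
that it correctly differs from all other labels. -/
lemma IsValidTable.evalStep {T : CellTree (d + 1)} {L L' : LabelTable T} {x : Fin (d + 1) → ℝ}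
    {v : ℕ} (hL : IsValidTable σ T L) (h : EvalStep φ T L x v L') :
    IsValidTable σ T L' ∧ (∀ V t a, L V t = some a → L' V t = some a) ∧
      ∃ U s, x ∈ U.1.box ∧ SignType.sign (φ.eval x) = signOf s ∧ L' U s = some v := by
  obtain ⟨U, s, hxU, hxs, ⟨hv, rfl⟩ | ⟨hnone, hnew, hv, hL'⟩⟩ := h
  · exact ⟨hL, fun _ _ _ => id, U, s, hxU, hxs, hv⟩
  have hmono : ∀ V t a, L V t = some a → L' V t = some a := by
    intro V t a ha
    rw [hL' V t, ha]
    rintro ⟨⟩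
    simp [hnone] at ha
  -- a cell without a label is an isolated point of the graph
  have hisol : ∀ V, (cellGraph σ T s).Reachable U V → V = U := by
    rintro V ⟨w⟩
    cases w with
    | nil => rfl
    | cons hadj _ =>
      obtain ⟨a, ha⟩ := hL.exists_of_adj hadj
      simp [hnone] at ha
  have hfresh : ∀ V t b, (V, t) ≠ (U, s) → L' V t = some b →
      L V t = some b ∧ v ≠ b ∧ ¬ (s = t ∧ (cellGraph σ T s).Reachable U V) := by
    intro V t b hne hb
    rw [hL' V t hne] at hb
    refine ⟨hb, ?_, ?_⟩
    · rintro rfl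
      exact hnew V t hb
    · rintro ⟨rfl, hr⟩
      exact hne (by rw [hisol V hr])
  refine ⟨⟨?_, fun hadj => ?_⟩, hmono, U, s, hxU, hxs, hv⟩
  · intro V W t u a b ha hb
    by_cases h1 : (V, t) = (U, s) <;> by_cases h2 : (W, u) = (U, s)
    · cases h1
      cases h2
      rw [ha] at hb
      simpa using hb
    · cases h1
      obtain ⟨-, h3, h4⟩ := hfresh W u b h2 hb
      obtain rfl : v = a := by simpa [hv] using ha
      exact iff_of_false h3 h4
    · cases h2
      obtain ⟨-, h3, h4⟩ := hfresh V t a h1 ha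
      obtain rfl : v = b := by simpa [hv] using hb
      refine iff_of_false h3.symm ?_
      rintro ⟨rfl, hr⟩
      exact h4 ⟨rfl, hr.symm⟩
    · exact hL.eq_iff (hfresh V t a h1 ha).1 (hfresh W u b h2 hb).1
  · obtain ⟨a, ha⟩ := hL.exists_of_adj hadj
    exact ⟨a, hmono _ _ _ ha⟩

lemma IsValidTable.session {T : CellTree (d + 1)} {L L' : LabelTable T}
    {h : List ((Fin (d + 1) → ℝ) × ℕ)} (hL : IsValidTable σ T L) (hs : Session φ T L h L') :
    IsValidTable σ T L' ∧ (∀ V t a, L V t = some a → L' V t = some a) ∧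
      ∀ x v, (x, v) ∈ h →
        ∃ U s, x ∈ U.1.box ∧ SignType.sign (φ.eval x) = signOf s ∧ L' U s = some v := by
  induction hs with
  | nil L => exact ⟨hL, fun _ _ _ => id, by simp⟩
  | cons hstep _ ih =>
    obtain ⟨h1, h2, U, s, hxU, hxs, hv⟩ := hL.evalStep hstep
    obtain ⟨h3, h4, h5⟩ := ih h1
    refine ⟨h3, fun V t a ha => h4 V t a (h2 V t a ha), fun y w hy => ?_⟩
    rcases List.mem_cons.1 hy with hy | hy
    · cases hy
      exact ⟨U, s, hxU, hxs, h4 _ _ _ hv⟩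
    · exact h5 y w hy

lemma exists_evalStep (σ : SignEvaluator) (Λ : ℕ) (L : LabelTable (subdivide σ Λ φ))
    {x : Fin (d + 1) → ℝ} (hx : x ∈ domain φ) : ∃ v L', EvalStep φ (subdivide σ Λ φ) L x v L' := by
  classical
  obtain ⟨U, hU⟩ := exists_leaf_mem_box σ Λ hx.1
  obtain ⟨s, hs⟩ := exists_sign_eq_signOf (show φ.eval x ≠ 0 from hx.2)
  rcases hL : L U s with _ | v
  · have : Finite (subdivide σ Λ φ).leaves := (CellTree.finite_leaves _).to_subtype
    obtain ⟨v, hv⟩ := (finite_range fun p : (subdivide σ Λ φ).leaves × Bool =>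
      (L p.1 p.2).getD 0).exists_notMem
    refine ⟨v, fun V t => if (V, t) = (U, s) then some v else L V t, U, s, hU, hs,
      Or.inr ⟨hL, fun V t h => hv ⟨(V, t), by simp [h]⟩, by simp, fun V t h => if_neg h⟩⟩
  · exact ⟨v, L, U, s, hU, hs, Or.inl ⟨hL, rfl⟩⟩

/-- Two evaluated points carry the label of cells containing them, so that equality of labels is
reachability in the cell graph of their sign, and this is the existence of a path in `Ω`. -/
theorem labelingIsExact (hσ : IsSignEvaluation σ) (hf : IsFaceConsistent σ)
    (hsc : ∀ U ∈ (subdivide σ Λ φ).leaves, IsSimplyConnected σ U) : LabelingIsExact σ Λ φ := by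
  refine ⟨exists_isInitialTable _ _, fun L₀ hL₀ h L hs =>
    ⟨fun x hx => exists_evalStep σ Λ L hx, fun x v y w hxv hyw => ?_⟩⟩
  obtain ⟨hL, -, hmem⟩ := hL₀.isValidTable.session hs
  obtain ⟨U, s, hxU, hxs, hU⟩ := hmem x v hxv
  obtain ⟨V, t, hyV, hyt, hV⟩ := hmem y w hyw
  rw [hL.eq_iff hU hV]
  refine ⟨⟨?_, fun hj => ?_⟩, fun hx hy hvw => ?_⟩
  · rintro ⟨rfl, hr⟩
    exact (joinedIn_of_reachable hσ hf hsc hr hxU hyV hxs hyt).mono signSet_subset_domain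
  · exact ⟨signOf_injective (by rw [← hxs, ← hyt, sign_eq_of_joinedIn hj]),
      reachable_of_joinedIn hσ hxU hyV hxs hj⟩
  · have hst := ((hL.eq_iff hU hV).1 hvw).1
    rw [sign_pos hx] at hxs
    rw [sign_neg hy, ← hst, ← hxs] at hyt
    exact absurd hyt (by decide)

/-! ### Range evaluation -/

lemma foldl_max_min {ι : Type*} (p : ι → Prop) [DecidablePred p] (f g : ι → ℝ) (l : List ι)
    (I : ℝ × ℝ) :
    let R := l.foldl (fun I k => if p k then (max I.1 (f k), min I.2 (g k)) else I) I
    (I.1 ≤ R.1 ∧ R.2 ≤ I.2) ∧ (∀ k ∈ l, p k → f k ≤ R.1 ∧ R.2 ≤ g k) ∧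
      (R.1 = I.1 ∨ ∃ k, p k ∧ R.1 = f k) ∧ (R.2 = I.2 ∨ ∃ k, p k ∧ R.2 = g k) := by
  induction l generalizing I with
  | nil => simp
  | cons a l ih =>
    simp only [List.foldl_cons]
    by_cases ha : p a
    · simp only [if_pos ha]
      obtain ⟨⟨h1, h2⟩, h3, h4, h5⟩ := ih (max I.1 (f a), min I.2 (g a))
      simp only [max_le_iff, le_min_iff] at h1 h2
      refine ⟨⟨h1.1, h2.1⟩, fun k hk hpk => ?_, ?_, ?_⟩
      · rcases List.mem_cons.1 hk with rfl | hk
        · exact ⟨h1.2, h2.2⟩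
        · exact h3 k hk hpk
      · rcases h4 with h | h
        · rcases max_choice I.1 (f a) with h' | h'
          · exact Or.inl (h.trans h')
          · exact Or.inr ⟨a, ha, h.trans h'⟩
        · exact Or.inr h
      · rcases h5 with h | h
        · rcases min_choice I.2 (g a) with h' | h'
          · exact Or.inl (h.trans h')
          · exact Or.inr ⟨a, ha, h.trans h'⟩
        · exact Or.inr h
    · simp only [if_neg ha]
      obtain ⟨h1, h3, h4, h5⟩ := ih I
      refine ⟨h1, fun k hk hpk => ?_, h4, h5⟩
      rcases List.mem_cons.1 hk with rfl | hk
      · exact absurd hpk ha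
      · exact h3 k hk hpk

/-- In dimension greater than one, the endpoints of the range are the best ones among the extreme
coefficients and the hulls of the ranges on the pairs of faces. -/
lemma evalRange_spec (P : BernsteinPoly (d + 2)) :
    (P.minCoeff ≤ (evalRange P).1 ∧ (evalRange P).2 ≤ P.maxCoeff) ∧
    (∀ k, P.CoeffMonotone k →
      min (evalRange (P.face k false)).1 (evalRange (P.face k true)).1 ≤ (evalRange P).1 ∧
      (evalRange P).2 ≤ max (evalRange (P.face k false)).2 (evalRange (P.face k true)).2) ∧
    ((evalRange P).1 = P.minCoeff ∨ ∃ k, P.CoeffMonotone k ∧ (evalRange P).1 =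
      min (evalRange (P.face k false)).1 (evalRange (P.face k true)).1) ∧
    ((evalRange P).2 = P.maxCoeff ∨ ∃ k, P.CoeffMonotone k ∧ (evalRange P).2 =
      max (evalRange (P.face k false)).2 (evalRange (P.face k true)).2) := by
  classical
  have h := foldl_max_min (fun k => P.CoeffMonotone k)
    (fun k => min (evalRange (P.face k false)).1 (evalRange (P.face k true)).1)
    (fun k => max (evalRange (P.face k false)).2 (evalRange (P.face k true)).2)
    (List.finRange (d + 2)) (P.minCoeff, P.maxCoeff)
  rw [evalRange]
  refine ⟨h.1, fun k hk => ?_, h.2.2⟩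
  exact h.2.1 k (List.mem_finRange k) hk

lemma indices_dim_zero (P : BernsteinPoly 0) : P.indices = {0} :=
  Finset.eq_singleton_iff_unique_mem.2
    ⟨mem_indices.2 fun j => j.elim0, fun _ _ => Subsingleton.elim _ _⟩

lemma evalRange_dim_zero (P : BernsteinPoly 0) : evalRange P = (P.coeff 0, P.coeff 0) := by
  simp [evalRange, minCoeff, maxCoeff, indices_dim_zero]

lemma eval_dim_zero (P : BernsteinPoly 0) (x : Fin 0 → ℝ) : P.eval x = P.coeff 0 := by
  simp [eval, indices_dim_zero]

lemma BernsteinPoly.CoeffMonotone.exists_face_eval {P : BernsteinPoly (d + 1)} {k : Fin (d + 1)}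
    (h : P.CoeffMonotone k) {x : Fin (d + 1) → ℝ} (hx : x ∈ P.box) :
    (∃ up, (P.face k up).eval (k.removeNth x) ≤ P.eval x) ∧
      ∃ up, P.eval x ≤ (P.face k up).eval (k.removeNth x) := by
  have hy := removeNth_mem_box hx k false
  have hxk : x k ∈ Icc (P.lo k) (P.hi k) := mem_box.1 hx k
  have h0 := P.faceCoord_mem k false
  have h1 := P.faceCoord_mem k true
  simp only [eval_face]
  rcases h.monotoneOn_or_antitoneOn with hm | hm
  · have h2 := hm _ hy h0 hxk hxk.1
    have h3 := hm _ hy hxk h1 hxk.2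
    simp only [Fin.insertNth_self_removeNth] at h2 h3
    exact ⟨⟨_, h2⟩, ⟨_, h3⟩⟩
  · have h2 := hm _ hy h0 hxk hxk.1
    have h3 := hm _ hy hxk h1 hxk.2
    simp only [Fin.insertNth_self_removeNth] at h2 h3
    exact ⟨⟨_, h3⟩, ⟨_, h2⟩⟩

lemma BernsteinPoly.CoeffMonotone.exists_face_coeff {P : BernsteinPoly (d + 1)} {k : Fin (d + 1)}
    (h : P.CoeffMonotone k) {i : Fin (d + 1) → ℕ} (hi : i ∈ P.indices) :
    (∃ up, (P.face k up).coeff (k.removeNth i) ≤ P.coeff i) ∧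
      ∃ up, P.coeff i ≤ (P.face k up).coeff (k.removeNth i) := by
  set c : ℕ → ℝ := fun l => P.coeff (k.insertNth (α := fun _ => ℕ) l (k.removeNth i)) with hc
  rw [← Fin.insertNth_self_removeNth k i, insertNth_mem_indices (m := 0)] at hi
  have hci : P.coeff i = c (i k) := by simp [hc]
  have h0 : (P.face k false).coeff (k.removeNth i) = c 0 := rfl
  have h1 : (P.face k true).coeff (k.removeNth i) = c (P.deg k) := rfl
  rw [hci]
  rcases h with h | h
  · have hm : MonotoneOn c (Iic (P.deg k)) := by
      refine monotoneOn_of_le_add_one ordConnected_Iic fun l _ hl hl' => ?_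
      have := h (k.insertNth (α := fun _ => ℕ) l (k.removeNth i))
        (insertNth_mem_indices.2 ⟨hl, hi.2⟩) (by simpa using hl')
      rwa [insertNth_add_single] at this
    exact ⟨⟨false, h0 ▸ hm (Nat.zero_le _) hi.1 (Nat.zero_le _)⟩,
      ⟨true, h1 ▸ hm hi.1 (mem_Iic.2 le_rfl) hi.1⟩⟩
  · have hm : AntitoneOn c (Iic (P.deg k)) := by
      refine antitoneOn_of_add_one_le ordConnected_Iic fun l _ hl hl' => ?_
      have := h (k.insertNth (α := fun _ => ℕ) l (k.removeNth i))
        (insertNth_mem_indices.2 ⟨hl, hi.2⟩) (by simpa using hl')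
      rwa [insertNth_add_single] at this
    exact ⟨⟨true, h1 ▸ hm hi.1 (mem_Iic.2 le_rfl) hi.1⟩,
      ⟨false, h0 ▸ hm (Nat.zero_le _) hi.1 (Nat.zero_le _)⟩⟩

lemma min_apply_bool_le {f : Bool → ℝ} (b : Bool) : min (f false) (f true) ≤ f b := by
  cases b <;> simp

lemma le_max_apply_bool {f : Bool → ℝ} (b : Bool) : f b ≤ max (f false) (f true) := by
  cases b <;> simp

lemma eval_mem_evalRange : ∀ {d : ℕ} (P : BernsteinPoly d) {x : Fin d → ℝ}, x ∈ P.box →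
    P.eval x ∈ Icc (evalRange P).1 (evalRange P).2
  | 0, P, x, _ => by simp [evalRange_dim_zero, eval_dim_zero]
  | 1, P, x, hx => by
    rw [evalRange]
    split_ifs
    · have hb : BddBelow (P.eval '' P.box) :=
        ⟨P.minCoeff, forall_mem_image.2 fun _ hy => P.minCoeff_le_eval hy⟩
      have ha : BddAbove (P.eval '' P.box) :=
        ⟨P.maxCoeff, forall_mem_image.2 fun _ hy => P.eval_le_maxCoeff hy⟩
      exact ⟨csInf_le hb (mem_image_of_mem _ hx), le_csSup ha (mem_image_of_mem _ hx)⟩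
    · exact ⟨P.minCoeff_le_eval hx, P.eval_le_maxCoeff hx⟩
  | d + 2, P, x, hx => by
    obtain ⟨-, -, h1, h2⟩ := evalRange_spec P
    constructor
    · rcases h1 with h1 | ⟨k, hk, h1⟩
      · exact h1 ▸ P.minCoeff_le_eval hx
      · obtain ⟨up, hup⟩ := (hk.exists_face_eval hx).1
        have := (eval_mem_evalRange (P.face k up) (removeNth_mem_box hx k up)).1
        rw [h1]
        exact (min_apply_bool_le (f := fun up => (evalRange (P.face k up)).1) up).trans
          (this.trans hup)
    · rcases h2 with h2 | ⟨k, hk, h2⟩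
      · exact h2 ▸ P.eval_le_maxCoeff hx
      · obtain ⟨up, hup⟩ := (hk.exists_face_eval hx).2
        have := (eval_mem_evalRange (P.face k up) (removeNth_mem_box hx k up)).2
        rw [h2]
        exact (hup.trans this).trans
          (le_max_apply_bool (f := fun up => (evalRange (P.face k up)).2) up)

lemma evalRange_fst_le_snd (P : BernsteinPoly d) : (evalRange P).1 ≤ (evalRange P).2 :=
  nonempty_Icc.1 ⟨_, eval_mem_evalRange P P.lo_mem_box⟩

lemma evalRange_bounds : ∀ {d : ℕ} (P : BernsteinPoly d),
    P.minCoeff ≤ (evalRange P).1 ∧ (evalRange P).2 ≤ P.maxCoeff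
  | 0, P => by simp [evalRange]
  | 1, P => by
    rw [evalRange]
    split_ifs
    · have hne : (P.eval '' P.box).Nonempty := ⟨_, mem_image_of_mem _ P.lo_mem_box⟩
      exact ⟨le_csInf hne (forall_mem_image.2 fun _ hy => P.minCoeff_le_eval hy),
        csSup_le hne (forall_mem_image.2 fun _ hy => P.eval_le_maxCoeff hy)⟩
    · exact ⟨le_rfl, le_rfl⟩
  | d + 2, P => (evalRange_spec P).1

lemma evalRange_subset_hull {P : BernsteinPoly (d + 1)} {k : Fin (d + 1)}
    (hk : P.CoeffMonotone k) :
    min (evalRange (P.face k false)).1 (evalRange (P.face k true)).1 ≤ (evalRange P).1 ∧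
      (evalRange P).2 ≤ max (evalRange (P.face k false)).2 (evalRange (P.face k true)).2 := by
  cases d with
  | succ d => exact (evalRange_spec P).2.1 k hk
  | zero =>
    have hmin := fun up => min_apply_bool_le (f := fun up => (evalRange (P.face k up)).1) up
    have hmax := fun up => le_max_apply_bool (f := fun up => (evalRange (P.face k up)).2) up
    rw [show evalRange P = _ from evalRange.eq_2 P]
    split_ifs
    · have hne : (P.eval '' P.box).Nonempty := ⟨_, mem_image_of_mem _ P.lo_mem_box⟩
      refine ⟨le_csInf hne (forall_mem_image.2 fun x hx => ?_),
        csSup_le hne (forall_mem_image.2 fun x hx => ?_)⟩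
      · obtain ⟨up, hup⟩ := (hk.exists_face_eval hx).1
        exact (hmin up).trans
          ((eval_mem_evalRange _ (removeNth_mem_box hx k up)).1.trans hup)
      · obtain ⟨up, hup⟩ := (hk.exists_face_eval hx).2
        exact (hup.trans (eval_mem_evalRange _ (removeNth_mem_box hx k up)).2).trans (hmax up)
    · have hcoeff : ∀ (up : Bool) (i : Fin 0 → ℕ),
          (P.face k up).coeff i = (P.face k up).coeff 0 := fun up i => by
        rw [Subsingleton.elim i 0]
      refine ⟨Finset.le_inf' P.indices_nonempty _ fun i hi => ?_,
        Finset.sup'_le P.indices_nonempty _ fun i hi => ?_⟩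
      · obtain ⟨up, hup⟩ := (hk.exists_face_coeff hi).1
        refine (hmin up).trans ?_
        rwa [evalRange_dim_zero, ← hcoeff up (k.removeNth i)]
      · obtain ⟨up, hup⟩ := (hk.exists_face_coeff hi).2
        refine le_trans ?_ (hmax up)
        rwa [evalRange_dim_zero, ← hcoeff up (k.removeNth i)]

lemma minCoeff_le_minCoeff_face (P : BernsteinPoly (d + 1)) (k : Fin (d + 1)) (up : Bool) :
    P.minCoeff ≤ (P.face k up).minCoeff ∧ (P.face k up).maxCoeff ≤ P.maxCoeff := by
  have h : ∀ i ∈ (P.face k up).indices,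
      k.insertNth (α := fun _ => ℕ) (if up then P.deg k else 0) i ∈ P.indices := fun i hi =>
    insertNth_mem_indices.2 ⟨by cases up <;> simp, hi⟩
  exact ⟨Finset.le_inf' _ _ fun i hi => P.minCoeff_le_coeff (h i hi),
    Finset.sup'_le _ _ fun i hi => P.coeff_le_maxCoeff (h i hi)⟩

/-- A strict sign of the range is inherited by the faces. If it was found through a direction of
monotonicity other than that of the face, the face is monotone in this direction, too, and its own
faces are faces of the faces that were used. -/
lemma evalRange_face_sign (P : BernsteinPoly (d + 1)) (k : Fin (d + 1)) (up : Bool) :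
    (0 < (evalRange P).1 → 0 < (evalRange (P.face k up)).1) ∧
      ((evalRange P).2 < 0 → (evalRange (P.face k up)).2 < 0) := by
  induction d with
  | zero =>
    have h := eval_mem_evalRange P
      (insertNth_mem_box.2 ⟨P.faceCoord_mem k up, (P.face k up).lo_mem_box⟩)
    rw [← eval_face, eval_dim_zero] at h
    rw [evalRange_dim_zero]
    exact ⟨fun h' => h'.trans_le h.1, fun h' => h.2.trans_lt h'⟩
  | succ d ih =>
    obtain ⟨-, -, h1, h2⟩ := evalRange_spec P
    have hc := minCoeff_le_minCoeff_face P k up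
    have hb := evalRange_bounds (P.face k up)
    constructor
    · intro hpos
      rcases h1 with h1 | ⟨i, hi, h1⟩
      · exact (h1 ▸ hpos).trans_le (hc.1.trans hb.1)
      · rw [h1, lt_min_iff] at hpos
        rcases eq_or_ne i k with rfl | hik
        · cases up
          · exact hpos.1
          · exact hpos.2
        · obtain ⟨j, rfl⟩ := Fin.exists_succAbove_eq hik
          refine lt_of_lt_of_le (lt_min ?_ ?_) (evalRange_subset_hull (hi.face up)).1
          · rw [face_face]
            exact (ih _ _).1 hpos.1
          · rw [face_face]
            exact (ih _ _).1 hpos.2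
    · intro hneg
      rcases h2 with h2 | ⟨i, hi, h2⟩
      · exact (hb.2.trans hc.2).trans_lt (h2 ▸ hneg)
      · rw [h2, max_lt_iff] at hneg
        rcases eq_or_ne i k with rfl | hik
        · cases up
          · exact hneg.1
          · exact hneg.2
        · obtain ⟨j, rfl⟩ := Fin.exists_succAbove_eq hik
          refine lt_of_le_of_lt (evalRange_subset_hull (hi.face up)).2 (max_lt ?_ ?_)
          · rw [face_face]
            exact (ih _ _).2 hneg.1
          · rw [face_face]
            exact (ih _ _).2 hneg.2

lemma sign_image_Icc_eq_one {a b : ℝ} (hab : a ≤ b) :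
    SignType.sign '' Icc a b = {1} ↔ 0 < a := by
  constructor
  · intro h
    have : SignType.sign a ∈ ({1} : Set SignType) := h ▸ mem_image_of_mem _ (left_mem_Icc.2 hab)
    exact sign_eq_one_iff.1 this
  · intro h
    refine eq_singleton_iff_unique_mem.2 ⟨⟨a, left_mem_Icc.2 hab, sign_pos h⟩, ?_⟩
    rintro _ ⟨r, hr, rfl⟩
    exact sign_pos (h.trans_le hr.1)

lemma sign_image_Icc_eq_neg_one {a b : ℝ} (hab : a ≤ b) :
    SignType.sign '' Icc a b = {-1} ↔ b < 0 := by
  constructor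
  · intro h
    have : SignType.sign b ∈ ({-1} : Set SignType) := h ▸ mem_image_of_mem _ (right_mem_Icc.2 hab)
    exact sign_eq_neg_one_iff.1 this
  · intro h
    refine eq_singleton_iff_unique_mem.2 ⟨⟨b, right_mem_Icc.2 hab, sign_neg h⟩, ?_⟩
    rintro _ ⟨r, hr, rfl⟩
    exact sign_neg (hr.2.trans_lt h)

lemma union_subset_unionZero (s t : Set SignType) : s ∪ t ⊆ unionZero s t := by
  unfold unionZero
  split_ifs with h
  · rw [h]
    rintro x (rfl | rfl) <;> simp
  · rfl

/-- The operation `∪₀` accounts for the signs in the hull of two intervals. -/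
lemma sign_mem_unionZero {a₁ b₁ a₂ b₂ r : ℝ} (h₁ : a₁ ≤ b₁) (h₂ : a₂ ≤ b₂)
    (hl : min a₁ a₂ ≤ r) (hu : r ≤ max b₁ b₂) :
    SignType.sign r ∈ unionZero (SignType.sign '' Icc a₁ b₁) (SignType.sign '' Icc a₂ b₂) := by
  have left : ∀ {t}, t ∈ Icc a₁ b₁ → SignType.sign t = SignType.sign r →
      SignType.sign r ∈ unionZero (SignType.sign '' Icc a₁ b₁) (SignType.sign '' Icc a₂ b₂) :=
    fun ht h => union_subset_unionZero _ _ (Or.inl ⟨_, ht, h⟩)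
  have right : ∀ {t}, t ∈ Icc a₂ b₂ → SignType.sign t = SignType.sign r →
      SignType.sign r ∈ unionZero (SignType.sign '' Icc a₁ b₁) (SignType.sign '' Icc a₂ b₂) :=
    fun ht h => union_subset_unionZero _ _ (Or.inr ⟨_, ht, h⟩)
  rcases lt_trichotomy r 0 with hr | rfl | hr
  · rcases min_le_iff.1 hl with h | h
    · exact left (left_mem_Icc.2 h₁) (by rw [sign_neg hr, sign_neg (h.trans_lt hr)])
    · exact right (left_mem_Icc.2 h₂) (by rw [sign_neg hr, sign_neg (h.trans_lt hr)])
  · by_cases hm₁ : (0 : ℝ) ∈ Icc a₁ b₁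
    · exact left hm₁ rfl
    by_cases hm₂ : (0 : ℝ) ∈ Icc a₂ b₂
    · exact right hm₂ rfl
    have hunion : SignType.sign '' Icc a₁ b₁ ∪ SignType.sign '' Icc a₂ b₂ = {-1, 1} := by
      rcases min_le_iff.1 hl with h | h
      · have hb : b₁ < 0 := not_le.1 fun h' => hm₁ ⟨h, h'⟩
        have ha : 0 < a₂ := not_le.1 fun h' =>
          hm₂ ⟨h', (le_max_iff.1 hu).resolve_left hb.not_ge⟩
        rw [(sign_image_Icc_eq_neg_one h₁).2 hb, (sign_image_Icc_eq_one h₂).2 ha]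
        rfl
      · have hb : b₂ < 0 := not_le.1 fun h' => hm₂ ⟨h, h'⟩
        have ha : 0 < a₁ := not_le.1 fun h' =>
          hm₁ ⟨h', (le_max_iff.1 hu).resolve_right hb.not_ge⟩
        rw [(sign_image_Icc_eq_neg_one h₂).2 hb, (sign_image_Icc_eq_one h₁).2 ha]
        exact union_comm _ _
    simp [unionZero, hunion]
  · rcases le_max_iff.1 hu with h | h
    · exact left (right_mem_Icc.2 h₁) (by rw [sign_pos hr, sign_pos (hr.trans_le h)])
    · exact right (right_mem_Icc.2 h₂) (by rw [sign_pos hr, sign_pos (hr.trans_le h)])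

theorem isSignEvaluation_rangeSign : IsSignEvaluation rangeSign where
  sign_mem P x hx := ⟨_, eval_mem_evalRange P hx, rfl⟩
  of_nonneg P h := by
    rintro ⟨r, hr, hneg⟩
    have : 0 ≤ P.minCoeff := Finset.le_inf' _ _ h
    exact (sign_eq_neg_one_iff.1 hneg).not_ge (this.trans ((evalRange_bounds P).1.trans hr.1))
  of_nonpos P h := by
    rintro ⟨r, hr, hpos⟩
    have : P.maxCoeff ≤ 0 := Finset.sup'_le _ _ h
    exact (sign_eq_one_iff.1 hpos).not_ge ((hr.2.trans (evalRange_bounds P).2).trans this)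
  of_monotone P k hk := by
    rintro _ ⟨r, hr, rfl⟩
    have h := evalRange_subset_hull hk
    exact sign_mem_unionZero (evalRange_fst_le_snd _) (evalRange_fst_le_snd _)
      (h.1.trans hr.1) (hr.2.trans h.2)
  of_dim_zero P := by simp [rangeSign, evalRange_dim_zero]

theorem isFaceConsistent_rangeSign : IsFaceConsistent rangeSign := by
  intro d P k up
  unfold rangeSign
  rw [sign_image_Icc_eq_one (evalRange_fst_le_snd _),
    sign_image_Icc_eq_one (evalRange_fst_le_snd _),
    sign_image_Icc_eq_neg_one (evalRange_fst_le_snd _),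
    sign_image_Icc_eq_neg_one (evalRange_fst_le_snd _)]
  exact evalRange_face_sign P k up

end BernsteinLabeling

theorem mainTheorem1 :
    (∀ (d : ℕ) (φ : BernsteinLabeling.BernsteinPoly (d + 1)) (Λ : ℕ),
      (∀ U ∈ (BernsteinLabeling.subdivide BernsteinLabeling.rangeSign Λ φ).leaves,
        BernsteinLabeling.IsSimplyConnected BernsteinLabeling.rangeSign U) →
      BernsteinLabeling.LabelingIsExact BernsteinLabeling.rangeSign Λ φ) ∧
    (∀ σ : BernsteinLabeling.SignEvaluator,
      BernsteinLabeling.IsSignEvaluation σ → BernsteinLabeling.IsFaceConsistent σ →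
      ∀ (d : ℕ) (φ : BernsteinLabeling.BernsteinPoly (d + 1)) (Λ : ℕ),
        (∀ U ∈ (BernsteinLabeling.subdivide σ Λ φ).leaves,
          BernsteinLabeling.IsSimplyConnected σ U) →
        BernsteinLabeling.LabelingIsExact σ Λ φ) :=
  ⟨fun _ _ _ => BernsteinLabeling.labelingIsExact BernsteinLabeling.isSignEvaluation_rangeSign
    BernsteinLabeling.isFaceConsistent_rangeSign,
    fun _ hσ hf _ _ _ => BernsteinLabeling.labelingIsExact hσ hf⟩
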